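/- Let $d\geq 1$ and let $A$ be a complex $d\times d$ matrix. For $\theta\in\mathbb R$ let $\lambda(\theta)$ be the smallest eigenvalue of the hermitian matrix $\operatorname{Re}(e^{-i\theta}A)$, where $\operatorname{Re}B=\tfrac12(B+B^*)$. Let $W=\{\langle x,Ax\rangle : x\in\mathbb C^d,\ \|x\|=1\}\subset\mathbb C$ be the numerical range of $A$. For $u$ in the unit circle $S^1\subset\mathbb C$ let $F_W(u)=\operatorname{argmin}_{z\in W}\operatorname{Re}(\overline{u}z)$. Call $u$ a regular normal vector of $W$ if $F_W(u)$ is a singleton, let $\operatorname{regn}(W)\subset S^1$ be the set of regular normal vectors, and let $\Xi_W=\{\theta\in\mathbb R: e^{i\theta}\in\operatorname{regn}(W)\}$. The reverse Gauss map $x_W:\operatorname{regn}(W)\to\mathbb C$ is defined by $F_W(u)=\{x_W(u)\}$. The maximal order of a function at a point is the number $k\in\{0,1,2,\dots\}$, if it exists, such that near the point the function is $k$ times, but not $k+1$ times, continuously differentiable. Analytic means real-analytic; the order and the analyticity of $x_W$ refer to the analytic manifold structure of $S^1$. Then the following hold. 1. The set $\Xi_W$ is open and $\lambda$ restricts to a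 $C^2$ map on $\Xi_W$. 2. There is an analytic curve $\theta\mapsto(\psi_1(\theta),\dots,\psi_d(\theta))$, $\theta\in\mathbb R$, of orthonormal bases of $\mathbb C^d$ consisting of eigenvectors of $\operatorname{Re}(e^{-i\theta}A)$. For every such curve, with eigenfunctions $\lambda_k(\theta)=\langle\psi_k(\theta),\operatorname{Re}(e^{-i\theta}A)\psi_k(\theta)\rangle$, $k=1,\dots,d$, and for every $\theta\in\mathbb R$, the function $\lambda$ is analytic at $\theta$ if and only if there is a $k$ such that $\lambda_k=\lambda$ in a neighborhood of $\theta$. 3. There are at most finitely many points in $[0,2\pi)$ at which $\lambda$ is not analytic. 4. At every $\theta\in\mathbb R$ at which $\lambda$ is not analytic, the maximal order of $\lambda$ exists and is even. 5. For all $\theta\in\Xi_W$, the map $x_W$ is analytic at $e^{i\theta}$ if and only if $\lambda$ is analytic at $\theta$. 6. For all $\theta\in\Xi_W$ at which $\lambda$ is not analytic, the maximal order of $x_W$ at $e^{i\theta}$ exists and equals the maximal order of $\lambda$ at $\theta$ minus one. -/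

import Mathlib

open scoped Manifold ContDiff

noncomputable section

namespace NumRange

variable {d : ℕ}

/-- The hermitian matrix `Re(e^{-iθ} A)`, where `Re B = (B + B*) / 2`. -/
def rotatedRe (A : Matrix (Fin d) (Fin d) ℂ) (θ : ℝ) : Matrix (Fin d) (Fin d) ℂ :=
  (realPart (Complex.exp (-(Complex.I * (θ : ℂ))) • A) : Matrix (Fin d) (Fin d) ℂ)

/-- The smallest eigenvalue `λ(θ)` of the hermitian matrix `Re(e^{-iθ} A)`. -/
def minEigenvalue (A : Matrix (Fin d) (Fin d) ℂ) (θ : ℝ) : ℝ :=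
  sInf (spectrum ℝ (rotatedRe A θ))

theorem rotatedRe_isHermitian (A : Matrix (Fin d) (Fin d) ℂ) (θ : ℝ) :
    (rotatedRe A θ).IsHermitian :=
  (realPart (Complex.exp (-(Complex.I * (θ : ℂ))) • A)).2

/-- The infimum in the definition of `minEigenvalue` is attained. -/
theorem minEigenvalue_isLeast [NeZero d] (A : Matrix (Fin d) (Fin d) ℂ) (θ : ℝ) :
    IsLeast (spectrum ℝ (rotatedRe A θ)) (minEigenvalue A θ) := by
  have h := (rotatedRe_isHermitian A θ).spectrum_real_eq_range_eigenvalues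
  have hfin : (spectrum ℝ (rotatedRe A θ)).Finite := h ▸ Set.finite_range _
  have hne : (spectrum ℝ (rotatedRe A θ)).Nonempty := h ▸ Set.range_nonempty _
  exact ⟨hne.csInf_mem hfin, fun x hx => csInf_le hfin.bddBelow hx⟩

/-- The numerical range `W = {⟨x, A x⟩ : ‖x‖ = 1}` (inner product linear in the second
argument). -/
def numericalRange (A : Matrix (Fin d) (Fin d) ℂ) : Set ℂ :=
  {z | ∃ x : EuclideanSpace ℂ (Fin d), ‖x‖ = 1 ∧ z = inner ℂ x (Matrix.toEuclideanLin A x)}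

/-- The exposed face `F_K(u)` of `K ⊆ ℂ` with inner normal vector `u`: the minimizers over `K` of
the Euclidean scalar product with `u`. -/
def exposedFace (K : Set ℂ) (u : ℂ) : Set ℂ :=
  {z | z ∈ K ∧ ∀ y ∈ K, inner ℝ z u ≤ inner ℝ y u}

/-- The regular normal vectors of `K`: the unit vectors `u` such that `F_K(u)` is a singleton. -/
def regn (K : Set ℂ) : Set Circle :=
  {u | ∃ z : ℂ, exposedFace K (u : ℂ) = {z}}

/-- The angles `Ξ_K` of the regular normal vectors of `K`. -/
def regnAngles (K : Set ℂ) : Set ℝ :=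
  {θ | Circle.exp θ ∈ regn K}

open scoped Classical in
/-- The reverse Gauss map `x_K`, given by `F_K(u) = {x_K(u)}` for `u ∈ regn K`. Outside of its
domain `regn K` it is given the value `0`. -/
def reverseGauss (K : Set ℂ) (u : Circle) : ℂ :=
  if h : u ∈ regn K then h.choose else 0

theorem exposedFace_eq_reverseGauss {K : Set ℂ} {u : Circle} (hu : u ∈ regn K) :
    exposedFace K (u : ℂ) = {reverseGauss K u} := by
  rw [reverseGauss, dif_pos hu]
  exact hu.choose_spec

/-- `ψ₁, …, ψ_d` is a (real-)analytic curve, defined on all of `ℝ`, of orthonormal bases of `ℂ^d`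
which consist of eigenvectors of `Re(e^{-iθ} A)`. -/
structure IsAnalyticEigenbasis (A : Matrix (Fin d) (Fin d) ℂ)
    (ψ : Fin d → ℝ → EuclideanSpace ℂ (Fin d)) : Prop where
  analytic : ∀ (k : Fin d) (θ : ℝ), AnalyticAt ℝ (ψ k) θ
  orthonormal : ∀ θ : ℝ, Orthonormal ℂ (fun k => ψ k θ)
  eigenvector : ∀ (k : Fin d) (θ : ℝ), ∃ μ : ℂ,
    Module.End.HasEigenvector (Matrix.toEuclideanLin (rotatedRe A θ)) μ (ψ k θ)

/-- The eigenfunction `λ_k(θ) = ⟨ψ_k(θ), Re(e^{-iθ} A) ψ_k(θ)⟩` (a real number, because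
`Re(e^{-iθ} A)` is hermitian). -/
def eigenfunction (A : Matrix (Fin d) (Fin d) ℂ) (ψ : Fin d → ℝ → EuclideanSpace ℂ (Fin d))
    (k : Fin d) (θ : ℝ) : ℝ :=
  (inner ℂ (ψ k θ) (Matrix.toEuclideanLin (rotatedRe A θ) (ψ k θ))).re

/-- The maximal order of `f` at `θ` is `k`: locally at `θ`, the function `f` is `k` times, but not
`k + 1` times, continuously differentiable. -/
def HasMaximalOrder (f : ℝ → ℝ) (θ : ℝ) (k : ℕ) : Prop :=
  ContDiffAt ℝ (k : ℕ∞ω) f θ ∧ ¬ ContDiffAt ℝ ((k + 1 : ℕ) : ℕ∞ω) f θ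

/-- The maximal order at `u` of a map `f` on the unit circle is `k`: locally at `u`, the map `f` is
`k` times, but not `k + 1` times, continuously differentiable on the manifold `S¹`. -/
def CircleHasMaximalOrder (f : Circle → ℂ) (u : Circle) (k : ℕ) : Prop :=
  ContMDiffAt (𝓡 1) 𝓘(ℝ, ℂ) (k : ℕ∞ω) f u ∧
    ¬ ContMDiffAt (𝓡 1) 𝓘(ℝ, ℂ) ((k + 1 : ℕ) : ℕ∞ω) f u

/-- The map `f` on the unit circle is (real-)analytic at `u`, with respect to the analytic manifold
structure of `S¹`. -/
def CircleAnalyticAt (f : Circle → ℂ) (u : Circle) : Prop :=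
  ContMDiffAt (𝓡 1) 𝓘(ℝ, ℂ) ω f u

end NumRange

end

/-!
The numerical range `W` of `A` enters through its support function: the smallest eigenvalue `λ(θ)`
of `Re(e^{-iθ} A)` is the minimum of `Re(e^{-iθ} z)` over `z ∈ W`, and the exposed face at `e^{iθ}` is
the set of minimizers. Everything else follows from the fact that `λ` is the pointwise minimum of
finitely many analytic functions, the eigenfunctions of an analytic orthonormal eigenbasis.

*Existence of the eigenbasis* (Rellich's theorem). A family of monic polynomials with real roots and
analytic coefficients has analytic roots locally (`exists_analytic_roots_at`), by induction on the
degree. After a shift the roots sum up to zero. Their sum of squares vanishes to an even order `2k`,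
and division of the roots by `(t - t₀) ^ k` preserves analyticity of the coefficients, while the new
roots do not all coincide at `t₀` (`exists_scaled_roots`). Hence the polynomial has coprime factors
at `t₀`, and these extend analytically by the inverse function theorem
(`exists_analytic_factorization`). The roots are unique up to a permutation, so that analytic
continuation along `ℝ` (`exists_global_extension`) makes them global. This applies to characteristic
polynomials. An eigenvector is then a solution of a singular linear system over the ring of analytic
functions on `ℝ`, an integral domain; its zeros are cancelled by another continuation argument, as
normalized solutions are unique up to a sign (`exists_analytic_unit_vector`). Vectors that were
found before are excluded by adding their projections to the square of the shifted matrix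
(`exists_analytic_orthonormal_eigenvectors`).

*Branching.* A minimum `λ` of analytic functions agrees with some `λ_l` on the left and with some
`λ_k` on the right of a point. If `λ` is not analytic there, then `λ_k - λ_l` changes its sign,
hence it vanishes to an odd order `n + 1`, and `λ` is `λ_l` plus a truncated power
`max (t - t₀) 0 ^ (n + 1)` times a nonvanishing analytic function (`exists_branching_of_isMin`). The
maximal order is the even number `n` (`hasMaximalOrder_of_eventually_eq`).

*The reverse Gauss map.* If `z` lies in the exposed face at `θ` and `λ` is differentiable at `θ`,
then `Re(e^{-iφ} z) - λ(φ)` is minimal at `φ = θ`, whence `z = e^{iθ} (λ(θ) + i λ'(θ))` and `e^{iθ}`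
is regular. Conversely, at a regular angle both one-sided derivatives of `λ` are determined by the
unique point of the face, so that `n = 0` is impossible and `λ` is `C²`
(`exists_hasMaximalOrder_of_mem_regnAngles`). The formula for `z` shows that the reverse Gauss map
has one derivative less than `λ` (`contDiffAt_supportPoint_iff`).
-/

namespace NumRange

open Polynomial Filter Topology

/-! ### Monic polynomials with real roots -/

/-- The monic real polynomial `∏ i, (X - r i)` with prescribed roots. -/
noncomputable def rootPoly {n : ℕ} (r : Fin n → ℝ) : ℝ[X] := ∏ i, (X - C (r i))

theorem monic_rootPoly {n : ℕ} (r : Fin n → ℝ) : (rootPoly r).Monic :=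
  monic_prod_of_monic _ _ fun i _ => monic_X_sub_C (r i)

theorem natDegree_rootPoly {n : ℕ} (r : Fin n → ℝ) : (rootPoly r).natDegree = n := by
  rw [rootPoly, natDegree_prod_of_monic _ _ fun i _ => monic_X_sub_C (r i)]
  simp

theorem rootPoly_comp_perm {n : ℕ} (r : Fin n → ℝ) (σ : Equiv.Perm (Fin n)) :
    rootPoly (r ∘ σ) = rootPoly r :=
  Equiv.prod_comp σ fun i => X - C (r i)

theorem roots_rootPoly {n : ℕ} (r : Fin n → ℝ) :
    (rootPoly r).roots = Multiset.map r Finset.univ.val := by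
  rw [← roots_multiset_prod_X_sub_C (Multiset.map r Finset.univ.val), Multiset.map_map]
  rfl

/-- A monic polynomial determines its tuple of roots up to a permutation. -/
theorem exists_perm_of_rootPoly_eq {n : ℕ} {r s : Fin n → ℝ} (h : rootPoly r = rootPoly s) :
    ∃ σ : Equiv.Perm (Fin n), r = s ∘ σ := by
  classical
  have hm : Multiset.map r Finset.univ.val = Multiset.map s Finset.univ.val := by
    rw [← roots_rootPoly, ← roots_rootPoly, h]
  have hc (c : ℝ) : Nonempty ({i // r i = c} ≃ {i // s i = c}) := by
    have h1 := congrArg (Multiset.count c) hm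
    rw [Multiset.count_map, Multiset.count_map] at h1
    refine ⟨Fintype.equivOfCardEq ?_⟩
    rw [Fintype.card_subtype, Fintype.card_subtype]
    simpa [Finset.card_def, eq_comm] using h1
  have e := fun c => (hc c).some
  exact ⟨Equiv.ofFiberEquiv e, funext fun i => (Equiv.ofFiberEquiv_map e i).symm⟩

theorem rootPoly_append {n a b : ℕ} (h : n = a + b) (r : Fin a → ℝ) (s : Fin b → ℝ) :
    rootPoly (fun i : Fin n => Fin.append r s (Fin.cast h i)) = rootPoly r * rootPoly s := by
  subst h
  simp [rootPoly, Fin.prod_univ_add]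

theorem exists_eq_rootPoly {n : ℕ} {p : ℝ[X]} (hm : p.Monic) (hd : p.natDegree = n)
    (hs : p.Splits) : ∃ r : Fin n → ℝ, p = rootPoly r := by
  subst hd
  have hc : p.roots.toList.length = p.natDegree := by
    rw [Multiset.length_toList, hs.natDegree_eq_card_roots]
  refine ⟨fun i => p.roots.toList.get (Fin.cast hc.symm i), ?_⟩
  have h1 := hs.eq_prod_roots_of_monic hm
  conv_lhs => rw [h1, ← Multiset.coe_toList p.roots]
  have h2 : p.roots.toList.map (fun x => X - C x) =
      List.ofFn fun i => X - C (p.roots.toList.get i) := by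
    conv_lhs => rw [← List.ofFn_get p.roots.toList]
    rw [List.map_ofFn]
    rfl
  rw [Multiset.map_coe, Multiset.prod_coe, h2, List.prod_ofFn, rootPoly]
  exact Fintype.prod_equiv (finCongr hc) _ _ fun i => rfl

theorem splits_rootPoly {n : ℕ} (r : Fin n → ℝ) : (rootPoly r).Splits :=
  Splits.prod fun i _ => Splits.X_sub_C (r i)

theorem rootPoly_smul_comp {n : ℕ} (c : ℝ) (r : Fin n → ℝ) :
    (rootPoly (fun i => c * r i)).comp (C c * X) = C (c ^ n) * rootPoly r := by
  have : C (c ^ n) = ∏ _i : Fin n, (C c : ℝ[X]) := by simp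
  rw [rootPoly, rootPoly, prod_comp, this, ← Finset.prod_mul_distrib]
  refine Finset.prod_congr rfl fun i _ => ?_
  simp [mul_sub]

theorem coeff_rootPoly_smul {n : ℕ} {c : ℝ} (hc : c ≠ 0) (r : Fin n → ℝ) {i : ℕ} (hi : i ≤ n) :
    (rootPoly (fun j => c * r j)).coeff i = c ^ (n - i) * (rootPoly r).coeff i := by
  have h := congrArg (fun p => p.coeff i) (rootPoly_smul_comp c r)
  simp only [comp_C_mul_X_coeff, coeff_C_mul] at h
  have h1 : c ^ n = c ^ (n - i) * c ^ i := by rw [← pow_add, Nat.sub_add_cancel hi]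
  rw [h1] at h
  exact mul_right_cancel₀ (pow_ne_zero i hc) (by linarith)

theorem rootPoly_add_const {n : ℕ} (r : Fin n → ℝ) (c : ℝ) :
    rootPoly (fun i => r i - c) = (rootPoly r).comp (X + C c) := by
  rw [rootPoly, rootPoly, prod_comp]
  refine Finset.prod_congr rfl fun i _ => ?_
  simp only [sub_comp, X_comp, C_comp, C_sub]
  ring

theorem coeff_rootPoly_pred {n : ℕ} (hn : 0 < n) (r : Fin n → ℝ) :
    (rootPoly r).coeff (n - 1) = -∑ i, r i := by
  have := prod_X_sub_C_coeff_card_pred Finset.univ r (by simpa using hn)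
  simpa [rootPoly] using this

theorem expand_rootPoly_sq {n : ℕ} (r : Fin n → ℝ) :
    expand ℝ 2 (rootPoly (fun i => r i ^ 2)) = rootPoly r * rootPoly (fun i => -r i) := by
  rw [rootPoly, rootPoly, rootPoly, map_prod, ← Finset.prod_mul_distrib]
  refine Finset.prod_congr rfl fun i _ => ?_
  simp only [map_sub, expand_X, expand_C, map_pow, map_neg]
  ring

/-! ### Polynomials with analytic coefficients -/

/-- All coefficients of the family `p` of polynomials are analytic at `x₀`. -/
def AnalyticCoeffs {E : Type*} [NormedAddCommGroup E] [NormedSpace ℝ E] (p : E → ℝ[X]) (x₀ : E) :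
    Prop :=
  ∀ i, ContDiffAt ℝ ω (fun x => (p x).coeff i) x₀

namespace AnalyticCoeffs

variable {E : Type*} [NormedAddCommGroup E] [NormedSpace ℝ E] {p q : E → ℝ[X]} {x₀ : E}

theorem const (p : ℝ[X]) : AnalyticCoeffs (fun _ : E => p) x₀ := fun _ => contDiffAt_const

theorem C {f : E → ℝ} (hf : ContDiffAt ℝ ω f x₀) : AnalyticCoeffs (fun x => C (f x)) x₀ := by
  intro i
  simp only [coeff_C]
  by_cases h : i = 0
  · simpa [h] using hf
  · simpa [h] using contDiffAt_const

theorem add (hp : AnalyticCoeffs p x₀) (hq : AnalyticCoeffs q x₀) :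
    AnalyticCoeffs (fun x => p x + q x) x₀ := fun i => by
  simpa only [coeff_add] using (hp i).add (hq i)

theorem sub (hp : AnalyticCoeffs p x₀) (hq : AnalyticCoeffs q x₀) :
    AnalyticCoeffs (fun x => p x - q x) x₀ := fun i => by
  simpa only [coeff_sub] using (hp i).sub (hq i)

theorem mul (hp : AnalyticCoeffs p x₀) (hq : AnalyticCoeffs q x₀) :
    AnalyticCoeffs (fun x => p x * q x) x₀ := fun i => by
  simp only [coeff_mul]
  exact ContDiffAt.sum fun j _ => (hp _).mul (hq _)

theorem pow (hp : AnalyticCoeffs p x₀) (n : ℕ) : AnalyticCoeffs (fun x => p x ^ n) x₀ := by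
  induction n with
  | zero => simpa using const 1
  | succ n ih => simpa only [pow_succ] using ih.mul hp

theorem sum {ι : Type*} (s : Finset ι) {f : ι → E → ℝ[X]} (hf : ∀ i, AnalyticCoeffs (f i) x₀) :
    AnalyticCoeffs (fun x => ∑ i ∈ s, f i x) x₀ := fun j => by
  simp only [finsetSum_coeff]
  exact ContDiffAt.sum fun i _ => hf i j

theorem prod {ι : Type*} (s : Finset ι) {f : ι → E → ℝ[X]} (hf : ∀ i, AnalyticCoeffs (f i) x₀) :
    AnalyticCoeffs (fun x => ∏ i ∈ s, f i x) x₀ := by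
  classical
  induction s using Finset.induction_on with
  | empty => simpa using const 1
  | insert a s ha ih => simpa only [Finset.prod_insert ha] using (hf a).mul ih

theorem comp {n : ℕ} (hp : AnalyticCoeffs p x₀) (hn : ∀ x, (p x).natDegree ≤ n)
    (hq : AnalyticCoeffs q x₀) : AnalyticCoeffs (fun x => (p x).comp (q x)) x₀ := by
  have h (x : E) : (p x).comp (q x) =
      ∑ i ∈ Finset.range (n + 1), Polynomial.C ((p x).coeff i) * q x ^ i :=
    eval₂_eq_sum_range' _ (Nat.lt_succ_of_le (hn x)) _
  simp only [h]
  exact sum _ fun i => (C (hp i)).mul (hq.pow i)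

theorem congr (hp : AnalyticCoeffs p x₀) (h : ∀ᶠ x in 𝓝 x₀, q x = p x) : AnalyticCoeffs q x₀ :=
  fun i => (hp i).congr_of_eventuallyEq (h.mono fun x hx => by simp only [hx])

/-- Two families of polynomials with analytic coefficients that agree on a punctured neighborhood
agree on a neighborhood. -/
theorem eventually_eq {p q : ℝ → ℝ[X]} {t₀ : ℝ} {n : ℕ} (hp : AnalyticCoeffs p t₀)
    (hq : AnalyticCoeffs q t₀) (hpn : ∀ t, (p t).natDegree ≤ n) (hqn : ∀ t, (q t).natDegree ≤ n)
    (h : ∀ᶠ t in 𝓝[≠] t₀, p t = q t) : ∀ᶠ t in 𝓝 t₀, p t = q t := by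
  have h1 : ∀ i ∈ Finset.range (n + 1), ∀ᶠ t in 𝓝 t₀, (p t).coeff i = (q t).coeff i := fun i _ =>
    ((hp i).analyticAt.frequently_eq_iff_eventually_eq (hq i).analyticAt).1
      (h.mono fun t ht => by rw [ht]).frequently
  filter_upwards [(Finset.eventually_all _).2 h1] with t ht
  exact (ext_iff_natDegree_le (hpn t) (hqn t)).2 fun i hi =>
    ht i (Finset.mem_range.2 (Nat.lt_succ_of_le hi))

end AnalyticCoeffs

theorem analyticCoeffs_rootPoly {E : Type*} [NormedAddCommGroup E] [NormedSpace ℝ E] {n : ℕ}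
    {r : E → Fin n → ℝ} {x₀ : E} (hr : ContDiffAt ℝ ω r x₀) :
    AnalyticCoeffs (fun x => rootPoly (r x)) x₀ :=
  AnalyticCoeffs.prod _ fun i => (AnalyticCoeffs.const X).sub
    (AnalyticCoeffs.C (contDiffAt_pi.1 hr i))

theorem analyticAt_sum_roots {n : ℕ} {r : ℝ → Fin n → ℝ} {t₀ : ℝ}
    (h : AnalyticCoeffs (fun t => rootPoly (r t)) t₀) :
    ContDiffAt ℝ ω (fun t => ∑ i, r t i) t₀ := by
  rcases Nat.eq_zero_or_pos n with rfl | hn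
  · simpa using contDiffAt_const
  · have := (h (n - 1)).neg
    simpa [coeff_rootPoly_pred hn] using this

/-- The sum of the squares of the roots is minus a coefficient of the polynomial with the squared
roots, which is read off from `∏ i, (X ^ 2 - r i ^ 2) = ∏ i, (X - r i) * ∏ i, (X + r i)`. -/
theorem analyticAt_sum_sq_roots {n : ℕ} {r : ℝ → Fin n → ℝ} {t₀ : ℝ}
    (h : AnalyticCoeffs (fun t => rootPoly (r t)) t₀) :
    ContDiffAt ℝ ω (fun t => ∑ i, r t i ^ 2) t₀ := by
  refine analyticAt_sum_roots (r := fun t i => r t i ^ 2) fun i => ?_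
  have hneg : AnalyticCoeffs (fun t => rootPoly (fun i => -r t i)) t₀ := by
    have h1 (t : ℝ) : rootPoly (fun i => -r t i) =
        C ((-1) ^ n) * (rootPoly (r t)).comp (C (-1) * X) := by
      have := rootPoly_smul_comp (-1) (fun i => -r t i)
      simp only [neg_mul, one_mul, neg_neg] at this
      rw [this, ← mul_assoc, ← C_mul, ← pow_add, ← two_mul]
      simp
    simp only [h1]
    exact (AnalyticCoeffs.const _).mul (h.comp (fun t => (natDegree_rootPoly _).le)
      (AnalyticCoeffs.const _))
  have h2 := (h.mul hneg) (i * 2)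
  simp only [← expand_rootPoly_sq, coeff_expand_mul two_pos] at h2
  exact h2

/-! ### Analytic factorization of polynomials -/

/-- The polynomial of degree less than `n` with the given coefficients. -/
noncomputable def lowerPoly {n : ℕ} (u : Fin n → ℝ) : ℝ[X] := ∑ i, C (u i) * X ^ (i : ℕ)

theorem degree_lowerPoly_lt {n : ℕ} (u : Fin n → ℝ) : (lowerPoly u).degree < n :=
  degree_sum_fin_lt u

theorem coeff_lowerPoly {n : ℕ} (u : Fin n → ℝ) (i : Fin n) : (lowerPoly u).coeff i = u i := by
  simp [lowerPoly, finsetSum_coeff, coeff_C_mul, coeff_X_pow, Fin.val_inj]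

theorem lowerPoly_add_smul {n : ℕ} (u v : Fin n → ℝ) (s : ℝ) :
    lowerPoly (u + s • v) = lowerPoly u + C s * lowerPoly v := by
  simp only [lowerPoly, Finset.mul_sum, ← Finset.sum_add_distrib]
  refine Finset.sum_congr rfl fun i _ => ?_
  simp only [Pi.add_apply, Pi.smul_apply, smul_eq_mul, C_add, C_mul]
  ring

/-- The monic polynomial of degree `n` with the given lower coefficients. -/
noncomputable def monicPoly {n : ℕ} (u : Fin n → ℝ) : ℝ[X] := X ^ n + lowerPoly u

theorem monic_monicPoly {n : ℕ} (u : Fin n → ℝ) : (monicPoly u).Monic :=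
  monic_X_pow_add (degree_lowerPoly_lt u)

theorem degree_monicPoly {n : ℕ} (u : Fin n → ℝ) : (monicPoly u).degree = n := by
  rw [monicPoly, degree_add_eq_left_of_degree_lt, degree_X_pow]
  rw [degree_X_pow]
  exact degree_lowerPoly_lt u

theorem natDegree_monicPoly {n : ℕ} (u : Fin n → ℝ) : (monicPoly u).natDegree = n :=
  natDegree_eq_of_degree_eq_some (degree_monicPoly u)

theorem eq_monicPoly {n : ℕ} {p : ℝ[X]} (hp : p.Monic) (hn : p.natDegree = n) :
    p = monicPoly (fun i : Fin n => p.coeff i) := by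
  subst hn
  conv_lhs => rw [hp.as_sum, Finset.sum_range]
  rfl

theorem analyticCoeffs_monicPoly {E : Type*} [NormedAddCommGroup E] [NormedSpace ℝ E] {n : ℕ}
    {u : E → Fin n → ℝ} {x₀ : E} (hu : ContDiffAt ℝ ω u x₀) :
    AnalyticCoeffs (fun x => monicPoly (u x)) x₀ :=
  (AnalyticCoeffs.const _).add <| AnalyticCoeffs.sum _ fun i =>
    (AnalyticCoeffs.C (contDiffAt_pi.1 hu i)).mul (AnalyticCoeffs.const _)

/-- The lower coefficients of the product of two monic polynomials, as a function of the lower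
coefficients of the factors. -/
noncomputable def mulCoeffs (a b : ℕ) (x : (Fin a → ℝ) × (Fin b → ℝ)) : Fin (a + b) → ℝ :=
  fun k => (monicPoly x.1 * monicPoly x.2).coeff k

theorem contDiffAt_mulCoeffs {a b : ℕ} (x : (Fin a → ℝ) × (Fin b → ℝ)) :
    ContDiffAt ℝ ω (mulCoeffs a b) x :=
  contDiffAt_pi.2 fun k =>
    ((analyticCoeffs_monicPoly contDiffAt_fst).mul (analyticCoeffs_monicPoly contDiffAt_snd)) k

theorem fderiv_mulCoeffs_apply {a b : ℕ} (x v : (Fin a → ℝ) × (Fin b → ℝ)) (k : Fin (a + b)) :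
    fderiv ℝ (mulCoeffs a b) x v k =
      (lowerPoly v.1 * monicPoly x.2 + monicPoly x.1 * lowerPoly v.2).coeff k := by
  have h1 : HasDerivAt (fun s : ℝ => mulCoeffs a b (x + s • v))
      (fderiv ℝ (mulCoeffs a b) x v) 0 := by
    have hl : HasDerivAt (fun s : ℝ => x + s • v) v 0 := by
      simpa using ((hasDerivAt_id (0 : ℝ)).smul_const v).const_add x
    have hF : HasFDerivAt (mulCoeffs a b) (fderiv ℝ (mulCoeffs a b) x) (x + (0 : ℝ) • v) := by
      rw [zero_smul, add_zero]
      exact ((contDiffAt_mulCoeffs x).differentiableAt (by simp)).hasFDerivAt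
    exact hF.comp_hasDerivAt (0 : ℝ) hl
  have h2 := hasDerivAt_pi.1 h1 k
  refine h2.unique ?_
  have h3 (s : ℝ) : mulCoeffs a b (x + s • v) k = (monicPoly x.1 * monicPoly x.2).coeff k +
      s * (lowerPoly v.1 * monicPoly x.2 + monicPoly x.1 * lowerPoly v.2).coeff k +
      s ^ 2 * (lowerPoly v.1 * lowerPoly v.2).coeff k := by
    rw [← coeff_C_mul, ← coeff_C_mul, ← coeff_add, ← coeff_add, mulCoeffs]
    simp only [monicPoly, Prod.fst_add, Prod.snd_add, Prod.smul_fst, Prod.smul_snd,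
      lowerPoly_add_smul, C_pow]
    ring_nf
  simp only [h3]
  have h4 := (((hasDerivAt_id (0 : ℝ)).mul_const
    ((lowerPoly v.1 * monicPoly x.2 + monicPoly x.1 * lowerPoly v.2).coeff k)).const_add
      ((monicPoly x.1 * monicPoly x.2).coeff k)).fun_add
    ((hasDerivAt_pow 2 (0 : ℝ)).mul_const ((lowerPoly v.1 * lowerPoly v.2).coeff k))
  simpa using h4

/-- Multiplication of monic polynomials is an immersion at a pair of coprime factors: a tangent
vector in the kernel is a pair `(u, v)` of low degree with `u * g + f * v = 0`. -/
theorem fderiv_mulCoeffs_injective {a b : ℕ} (x : (Fin a → ℝ) × (Fin b → ℝ))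
    (hx : IsCoprime (monicPoly x.1) (monicPoly x.2)) :
    Function.Injective (fderiv ℝ (mulCoeffs a b) x) := by
  refine (injective_iff_map_eq_zero _).2 fun v hv => ?_
  have h0 : lowerPoly v.1 * monicPoly x.2 + monicPoly x.1 * lowerPoly v.2 = 0 := by
    have hd : (lowerPoly v.1 * monicPoly x.2 + monicPoly x.1 * lowerPoly v.2).degree <
        ((a + b : ℕ) : WithBot ℕ) := by
      refine (degree_add_le _ _).trans_lt (max_lt ?_ ?_)
      · rw [(monic_monicPoly x.2).degree_mul, degree_monicPoly, Nat.cast_add]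
        exact WithBot.add_lt_add_right (by simp) (degree_lowerPoly_lt _)
      · rw [degree_mul, degree_monicPoly, Nat.cast_add]
        exact WithBot.add_lt_add_left (by simp) (degree_lowerPoly_lt _)
    ext k
    by_cases hk : k < a + b
    · have := fderiv_mulCoeffs_apply x v ⟨k, hk⟩
      rw [hv] at this
      exact this.symm
    · rw [coeff_zero, coeff_eq_zero_of_degree_lt (hd.trans_le _)]
      exact_mod_cast not_lt.1 hk
  have hz {n : ℕ} {u : Fin n → ℝ} (h : lowerPoly u = 0) : u = 0 := funext fun i => by
    rw [← coeff_lowerPoly u i, h]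
    simp
  have h1 : monicPoly x.1 ∣ lowerPoly v.1 := hx.dvd_of_dvd_mul_right
    ⟨-lowerPoly v.2, by linear_combination h0⟩
  have h2 : monicPoly x.2 ∣ lowerPoly v.2 := hx.symm.dvd_of_dvd_mul_left
    ⟨-lowerPoly v.1, by linear_combination h0⟩
  refine Prod.ext (hz ?_) (hz ?_)
  · exact eq_zero_of_dvd_of_degree_lt h1 (by rw [degree_monicPoly]; exact degree_lowerPoly_lt _)
  · exact eq_zero_of_dvd_of_degree_lt h2 (by rw [degree_monicPoly]; exact degree_lowerPoly_lt _)

/-- An analytic family of monic polynomials whose value at `t₀` is the product of two coprime monic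
polynomials factors analytically near `t₀`. -/
theorem exists_analytic_factorization {p : ℝ → ℝ[X]} {t₀ : ℝ} {a b : ℕ}
    (hp : AnalyticCoeffs p t₀) (hm : ∀ t, (p t).Monic) (hd : ∀ t, (p t).natDegree = a + b)
    {f₀ g₀ : ℝ[X]} (hf : f₀.Monic) (hg : g₀.Monic) (hfa : f₀.natDegree = a)
    (hgb : g₀.natDegree = b) (hc : IsCoprime f₀ g₀) (h0 : p t₀ = f₀ * g₀) :
    ∃ (u : ℝ → Fin a → ℝ) (v : ℝ → Fin b → ℝ), ContDiffAt ℝ ω u t₀ ∧ ContDiffAt ℝ ω v t₀ ∧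
      ∀ᶠ t in 𝓝 t₀, p t = monicPoly (u t) * monicPoly (v t) := by
  set x₀ : (Fin a → ℝ) × (Fin b → ℝ) := (fun i => f₀.coeff i, fun i => g₀.coeff i) with hx₀
  have hf' : f₀ = monicPoly x₀.1 := eq_monicPoly hf hfa
  have hg' : g₀ = monicPoly x₀.2 := eq_monicPoly hg hgb
  rw [hf', hg'] at hc
  have hinj := fderiv_mulCoeffs_injective x₀ hc
  let e : ((Fin a → ℝ) × (Fin b → ℝ)) ≃L[ℝ] (Fin (a + b) → ℝ) :=
    (LinearMap.linearEquivOfInjective (fderiv ℝ (mulCoeffs a b) x₀).toLinearMap hinj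
      (by simp)).toContinuousLinearEquiv
  have he : HasFDerivAt (mulCoeffs a b) (e : _ →L[ℝ] _) x₀ := by
    have : (e : ((Fin a → ℝ) × (Fin b → ℝ)) →L[ℝ] (Fin (a + b) → ℝ)) =
      fderiv ℝ (mulCoeffs a b) x₀ := ContinuousLinearMap.ext fun v => rfl
    rw [this]
    exact ((contDiffAt_mulCoeffs x₀).differentiableAt (by simp)).hasFDerivAt
  have hω : (ω : ℕ∞ω) ≠ 0 := by simp
  let c : ℝ → Fin (a + b) → ℝ := fun t k => (p t).coeff k
  have hc' : ContDiffAt ℝ ω c t₀ := contDiffAt_pi.2 fun k => hp k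
  have hc₀ : c t₀ = mulCoeffs a b x₀ := by
    funext k
    simp only [c, h0, mulCoeffs, ← hf', ← hg']
  have hinv := (contDiffAt_mulCoeffs x₀).to_localInverse he hω
  rw [← hc₀] at hinv
  have hcomp := hinv.comp t₀ hc'
  refine ⟨_, _, contDiffAt_fst.comp t₀ hcomp, contDiffAt_snd.comp t₀ hcomp, ?_⟩
  have hr := ((contDiffAt_mulCoeffs x₀).hasStrictFDerivAt' he hω).eventually_right_inverse
  rw [← hc₀] at hr
  filter_upwards [hc'.continuousAt.eventually hr] with t ht
  set x := ((contDiffAt_mulCoeffs x₀).localInverse he hω) (c t) with hx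
  change p t = monicPoly x.1 * monicPoly x.2
  have hmm : (monicPoly x.1 * monicPoly x.2).Monic := (monic_monicPoly _).mul (monic_monicPoly _)
  have hmd : (monicPoly x.1 * monicPoly x.2).natDegree = a + b := by
    rw [(monic_monicPoly _).natDegree_mul (monic_monicPoly _), natDegree_monicPoly,
      natDegree_monicPoly]
  rw [eq_monicPoly (hm t) (hd t), eq_monicPoly hmm hmd]
  exact congrArg monicPoly ht.symm

/-! ### Analytic roots of polynomials with real roots, locally -/

/-- An analytic function which is `O((t - t₀) ^ m)` is divisible by `(t - t₀) ^ m`. -/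
theorem exists_eq_pow_mul_of_abs_le {f : ℝ → ℝ} {t₀ M : ℝ} {m : ℕ} (hf : ContDiffAt ℝ ω f t₀)
    (h : ∀ᶠ t in 𝓝[≠] t₀, |f t| ≤ M * |t - t₀| ^ m) :
    ∃ g : ℝ → ℝ, ContDiffAt ℝ ω g t₀ ∧ ∀ᶠ t in 𝓝 t₀, f t = (t - t₀) ^ m * g t := by
  by_cases hz : ∀ᶠ t in 𝓝 t₀, f t = 0
  · exact ⟨fun _ => 0, contDiffAt_const, hz.mono fun t ht => by simp [ht]⟩
  obtain ⟨j, u, hu, hu0, hfu⟩ := hf.analyticAt.exists_eventuallyEq_pow_smul_nonzero_iff.2 hz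
  rcases le_or_gt m j with hmj | hjm
  · refine ⟨fun t => (t - t₀) ^ (j - m) * u t, ?_, hfu.mono fun t ht => ?_⟩
    · exact ((contDiffAt_id.sub contDiffAt_const).pow _).mul hu.contDiffAt
    · rw [ht, ← mul_assoc, ← pow_add, Nat.add_sub_cancel' hmj, smul_eq_mul]
  · exfalso
    have h1 : ∀ᶠ t in 𝓝[≠] t₀, |u t| ≤ M * |t - t₀| ^ (m - j) := by
      filter_upwards [h, hfu.filter_mono nhdsWithin_le_nhds, self_mem_nhdsWithin] with t h1 h2 h3
      have hpos : 0 < |t - t₀| ^ j := pow_pos (abs_pos.2 (sub_ne_zero.2 h3)) j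
      have h4 : |t - t₀| ^ m = |t - t₀| ^ j * |t - t₀| ^ (m - j) := by
        rw [← pow_add, Nat.add_sub_cancel' hjm.le]
      rw [h2, smul_eq_mul, abs_mul, abs_pow, h4, mul_left_comm] at h1
      exact le_of_mul_le_mul_left h1 hpos
    have h2 : Tendsto (fun t => M * |t - t₀| ^ (m - j)) (𝓝[≠] t₀) (𝓝 0) := by
      have : ContinuousAt (fun t => M * |t - t₀| ^ (m - j)) t₀ := by fun_prop
      have h3 := this.tendsto
      simp only [sub_self, abs_zero, zero_pow (Nat.sub_ne_zero_of_lt hjm), mul_zero] at h3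
      exact h3.mono_left nhdsWithin_le_nhds
    have h3 : Tendsto (fun t => |u t|) (𝓝[≠] t₀) (𝓝 |u t₀|) :=
      hu.continuousAt.abs.tendsto.mono_left nhdsWithin_le_nhds
    exact hu0 (abs_eq_zero.1 (le_antisymm (le_of_tendsto_of_tendsto h3 h2 h1) (abs_nonneg _)))

theorem even_and_pos_of_pow_mul_nonneg {u : ℝ → ℝ} {t₀ : ℝ} {m : ℕ} (hu : ContinuousAt u t₀)
    (hu0 : u t₀ ≠ 0) (h : ∀ᶠ t in 𝓝 t₀, 0 ≤ (t - t₀) ^ m * u t) : Even m ∧ 0 < u t₀ := by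
  have hr : 0 < u t₀ := by
    by_contra hneg
    have hlt : u t₀ < 0 := lt_of_le_of_ne (not_lt.1 hneg) hu0
    have hev : ∀ᶠ t in 𝓝[>] t₀, u t < 0 ∧ 0 ≤ (t - t₀) ^ m * u t :=
      ((hu.eventually_lt_const hlt).and h).filter_mono nhdsWithin_le_nhds
    obtain ⟨t, ⟨h1, h2⟩, h3⟩ := (hev.and self_mem_nhdsWithin).exists
    exact absurd h2 (not_le.2 (mul_neg_of_pos_of_neg (pow_pos (sub_pos.2 h3) m) h1))
  refine ⟨?_, hr⟩
  by_contra hodd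
  rw [Nat.not_even_iff_odd] at hodd
  have hev : ∀ᶠ t in 𝓝[<] t₀, 0 < u t ∧ 0 ≤ (t - t₀) ^ m * u t :=
    ((hu.eventually_const_lt hr).and h).filter_mono nhdsWithin_le_nhds
  obtain ⟨t, ⟨h1, h2⟩, h3⟩ := (hev.and self_mem_nhdsWithin).exists
  exact absurd h2 (not_le.2 (mul_neg_of_neg_of_pos (hodd.pow_neg (sub_neg.2 h3)) h1))

/-- The coefficients of `rootPoly r` as a vector. -/
noncomputable def rootCoeffs {n : ℕ} (r : Fin n → ℝ) : Fin (n + 1) → ℝ :=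
  fun i => (rootPoly r).coeff i

theorem continuous_rootCoeffs (n : ℕ) : Continuous (rootCoeffs (n := n)) :=
  continuous_pi fun i => continuous_iff_continuousAt.2 fun _ =>
    (analyticCoeffs_rootPoly contDiffAt_id i).continuousAt

/-- The blow-up step. If the roots sum up to zero, then the order at `t₀` of the sum of their
squares is an even number `2 * k`, unless this sum vanishes identically. The roots are divided by
`(t - t₀) ^ k`; the quotients are roots of a polynomial with analytic coefficients again, and they
do not all coincide at `t₀`. -/
theorem exists_scaled_roots {n : ℕ} {r : ℝ → Fin n → ℝ} {t₀ : ℝ}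
    (h : AnalyticCoeffs (fun t => rootPoly (r t)) t₀) (hsum : ∀ t, ∑ i, r t i = 0)
    (hne : ¬ ∀ᶠ t in 𝓝 t₀, ∑ i, r t i ^ 2 = 0) :
    ∃ (k : ℕ) (ρ : ℝ → Fin n → ℝ), AnalyticCoeffs (fun t => rootPoly (ρ t)) t₀ ∧
      (∃ i j, ρ t₀ i ≠ ρ t₀ j) ∧ ∀ᶠ t in 𝓝[≠] t₀, r t = fun i => (t - t₀) ^ k * ρ t i := by
  obtain ⟨m, u, hu, hu0, hsu⟩ :=
    (analyticAt_sum_sq_roots h).analyticAt.exists_eventuallyEq_pow_smul_nonzero_iff.2 hne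
  simp only [smul_eq_mul] at hsu
  obtain ⟨hm, hupos⟩ := even_and_pos_of_pow_mul_nonneg hu.continuousAt hu0
    (hsu.mono fun t ht => ht ▸ Finset.sum_nonneg fun i _ => sq_nonneg _)
  obtain ⟨k, rfl⟩ := even_iff_exists_two_mul.1 hm
  set q : ℝ → Fin n → ℝ := fun t i => r t i / (t - t₀) ^ k with hq
  have hrq {t : ℝ} (ht : t ≠ t₀) : r t = fun i => (t - t₀) ^ k * q t i := by
    funext i
    rw [hq, mul_div_cancel₀ _ (pow_ne_zero k (sub_ne_zero.2 ht))]
  have hqsq : ∀ᶠ t in 𝓝[≠] t₀, ∑ i, q t i ^ 2 = u t := by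
    filter_upwards [hsu.filter_mono nhdsWithin_le_nhds, self_mem_nhdsWithin] with t h1 h2
    rw [hrq h2] at h1
    simp only [mul_pow, ← Finset.mul_sum, ← pow_mul, mul_comm k 2] at h1
    exact mul_left_cancel₀ (pow_ne_zero _ (sub_ne_zero.2 h2)) h1
  set B : ℝ := Real.sqrt (u t₀ + 1) with hB
  have hqB : ∀ᶠ t in 𝓝[≠] t₀, q t ∈ Set.Icc (fun _ : Fin n => -B) (fun _ => B) := by
    have hlt : ∀ᶠ t in 𝓝[≠] t₀, u t < u t₀ + 1 :=
      (hu.continuousAt.eventually_lt_const (lt_add_one _)).filter_mono nhdsWithin_le_nhds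
    filter_upwards [hqsq, hlt] with t h1 h2
    have h3 (i : Fin n) : |q t i| ≤ B := by
      refine Real.abs_le_sqrt (le_trans ?_ h2.le)
      rw [← h1]
      exact Finset.single_le_sum (f := fun i => q t i ^ 2) (fun i _ => sq_nonneg _)
        (Finset.mem_univ i)
    exact ⟨fun i => (abs_le.1 (h3 i)).1, fun i => (abs_le.1 (h3 i)).2⟩
  have hK : IsCompact (rootCoeffs '' Set.Icc (fun _ : Fin n => -B) (fun _ => B)) :=
    isCompact_Icc.image (continuous_rootCoeffs n)
  obtain ⟨M, hM⟩ := hK.isBounded.exists_norm_le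
  have hcoeff {t : ℝ} (ht : t ≠ t₀) (i : Fin (n + 1)) :
      (rootPoly (r t)).coeff i = ((t - t₀) ^ k) ^ (n - i) * (rootPoly (q t)).coeff i := by
    rw [hrq ht, coeff_rootPoly_smul (pow_ne_zero k (sub_ne_zero.2 ht)) _
      (Nat.lt_succ_iff.1 i.2)]
  have hg (i : Fin (n + 1)) : ∃ g : ℝ → ℝ, ContDiffAt ℝ ω g t₀ ∧
      ∀ᶠ t in 𝓝 t₀, (rootPoly (r t)).coeff i = (t - t₀) ^ (k * (n - i)) * g t := by
    refine exists_eq_pow_mul_of_abs_le (M := M) (h i) ?_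
    filter_upwards [hqB, self_mem_nhdsWithin] with t h1 h2
    rw [hcoeff h2, abs_mul, ← pow_mul, abs_pow, mul_comm]
    refine mul_le_mul_of_nonneg_right ?_ (by positivity)
    exact (norm_le_pi_norm (rootCoeffs (q t)) i).trans (hM _ ⟨_, h1, rfl⟩)
  choose g hg hgr using hg
  have hgq : ∀ᶠ t in 𝓝[≠] t₀, (fun i => g i t) = rootCoeffs (q t) := by
    filter_upwards [(eventually_all.2 hgr).filter_mono nhdsWithin_le_nhds, self_mem_nhdsWithin]
      with t h1 h2
    funext i
    have h3 := h1 i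
    rw [hcoeff h2, ← pow_mul] at h3
    exact (mul_left_cancel₀ (pow_ne_zero _ (sub_ne_zero.2 h2)) h3).symm
  -- The set of coefficient vectors of polynomials with roots in `[-B, B]` is closed, so that the
  -- limit polynomial has real roots, too.
  obtain ⟨ρ₀, -, hρ₀⟩ : (fun i => g i t₀) ∈
      rootCoeffs '' Set.Icc (fun _ : Fin n => -B) (fun _ => B) := by
    refine hK.isClosed.mem_of_tendsto (b := 𝓝[≠] t₀) (f := fun t i => g i t) ?_ ?_
    · exact (tendsto_pi_nhds.2 fun i => (hg i).continuousAt).mono_left nhdsWithin_le_nhds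
    · filter_upwards [hqB, hgq] with t h1 h2
      exact ⟨_, h1, h2.symm⟩
  set ρ : ℝ → Fin n → ℝ := Function.update q t₀ ρ₀ with hρ
  have hρt {t : ℝ} (ht : t ≠ t₀) : ρ t = q t := Function.update_of_ne ht _ _
  have hgρ : ∀ᶠ t in 𝓝 t₀, rootCoeffs (ρ t) = fun i => g i t := by
    rw [← nhdsNE_sup_pure, eventually_sup]
    refine ⟨?_, ?_⟩
    · filter_upwards [hgq, self_mem_nhdsWithin] with t h1 h2
      rw [h1, hρt h2]
    · simpa [hρ] using hρ₀
  have han : AnalyticCoeffs (fun t => rootPoly (ρ t)) t₀ := by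
    intro i
    by_cases hi : i < n + 1
    · exact (hg ⟨i, hi⟩).congr_of_eventuallyEq (hgρ.mono fun t ht => congrFun ht ⟨i, hi⟩)
    · refine (contDiffAt_const (c := (0 : ℝ))).congr_of_eventuallyEq
        (Eventually.of_forall fun t => ?_)
      exact coeff_eq_zero_of_natDegree_lt (by rw [natDegree_rootPoly]; omega)
  refine ⟨k, ρ, han, ?_, ?_⟩
  · by_contra! hall
    have hs0 : ∑ i, ρ t₀ i = 0 := by
      have := ((analyticAt_sum_roots han).analyticAt.frequently_eq_iff_eventually_eq
        (analyticAt_const (v := (0 : ℝ)))).1 (Eventually.frequently ?_)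
      · exact this.self_of_nhds
      · filter_upwards [self_mem_nhdsWithin] with t ht
        have h1 := hsum t
        rw [hrq ht, ← Finset.mul_sum] at h1
        rw [hρt ht]
        exact (mul_eq_zero.1 h1).resolve_left (pow_ne_zero k (sub_ne_zero.2 ht))
    have hs2 : ∑ i, ρ t₀ i ^ 2 = u t₀ := by
      have := ((analyticAt_sum_sq_roots han).analyticAt.frequently_eq_iff_eventually_eq
        hu).1 (Eventually.frequently ?_)
      · exact this.self_of_nhds
      · filter_upwards [hqsq, self_mem_nhdsWithin] with t h1 ht
        rw [hρt ht, h1]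
    have h0 (i : Fin n) : ρ t₀ i = 0 := by
      rw [Finset.sum_congr rfl fun j _ => hall j i] at hs0
      simpa [i.pos.ne'] using hs0
    simp only [h0] at hs2
    exact hu0 (by rw [← hs2]; simp)
  · filter_upwards [self_mem_nhdsWithin] with t ht
    rw [hρt ht, ← hrq ht]

/-- A family of polynomials with real roots that do not all coincide at `t₀` splits analytically
near `t₀` into two families of smaller degree with real roots. -/
theorem exists_split_roots {n : ℕ} {r : ℝ → Fin n → ℝ} {t₀ : ℝ}
    (h : AnalyticCoeffs (fun t => rootPoly (r t)) t₀) (hne : ∃ i j, r t₀ i ≠ r t₀ j) :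
    ∃ (a b : ℕ) (_ : n = a + b) (_ : a < n) (_ : b < n) (x : ℝ → Fin a → ℝ) (y : ℝ → Fin b → ℝ),
      AnalyticCoeffs (fun t => rootPoly (x t)) t₀ ∧ AnalyticCoeffs (fun t => rootPoly (y t)) t₀ ∧
      ∀ᶠ t in 𝓝 t₀, rootPoly (r t) = rootPoly (x t) * rootPoly (y t) := by
  classical
  obtain ⟨i₀, j₀, hij⟩ := hne
  set S : Finset (Fin n) := Finset.univ.filter fun i => r t₀ i = r t₀ i₀ with hS
  have hab : n = S.card + Sᶜ.card := by simp [Finset.card_add_card_compl]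
  have ha : 0 < S.card := Finset.card_pos.2 ⟨i₀, by simp [hS]⟩
  have hb : 0 < Sᶜ.card := Finset.card_pos.2 ⟨j₀, by simp [hS, hij.symm]⟩
  have hmon (T : Finset (Fin n)) : (∏ i ∈ T, (X - C (r t₀ i))).Monic :=
    monic_prod_of_monic _ _ fun i _ => monic_X_sub_C _
  have hdeg (T : Finset (Fin n)) : (∏ i ∈ T, (X - C (r t₀ i))).natDegree = T.card := by
    rw [natDegree_prod_of_monic _ _ fun i _ => monic_X_sub_C _]
    simp
  have hcop : IsCoprime (∏ i ∈ S, (X - C (r t₀ i))) (∏ i ∈ Sᶜ, (X - C (r t₀ i))) := by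
    refine IsCoprime.prod_left fun i hi => IsCoprime.prod_right fun j hj => ?_
    refine isCoprime_X_sub_C_of_isUnit_sub (sub_ne_zero.2 fun hc => ?_).isUnit
    simp only [hS, Finset.mem_compl, Finset.mem_filter, Finset.mem_univ, true_and] at hi hj
    exact hj (hc ▸ hi)
  obtain ⟨u, v, hu, hv, huv⟩ := exists_analytic_factorization h (fun t => monic_rootPoly _)
    (fun t => (natDegree_rootPoly _).trans hab) (hmon S) (hmon Sᶜ) (hdeg S) (hdeg Sᶜ) hcop
    (Finset.prod_mul_prod_compl S _).symm
  have hx (t : ℝ) : ∃ x : Fin S.card → ℝ, monicPoly (u t) ∣ rootPoly (r t) →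
      monicPoly (u t) = rootPoly x := by
    by_cases hd : monicPoly (u t) ∣ rootPoly (r t)
    · obtain ⟨x, hx⟩ := exists_eq_rootPoly (monic_monicPoly (u t)) (natDegree_monicPoly _)
        ((splits_rootPoly _).of_dvd (monic_rootPoly _).ne_zero hd)
      exact ⟨x, fun _ => hx⟩
    · exact ⟨0, fun h => absurd h hd⟩
  have hy (t : ℝ) : ∃ y : Fin Sᶜ.card → ℝ, monicPoly (v t) ∣ rootPoly (r t) →
      monicPoly (v t) = rootPoly y := by
    by_cases hd : monicPoly (v t) ∣ rootPoly (r t)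
    · obtain ⟨y, hy⟩ := exists_eq_rootPoly (monic_monicPoly (v t)) (natDegree_monicPoly _)
        ((splits_rootPoly _).of_dvd (monic_rootPoly _).ne_zero hd)
      exact ⟨y, fun _ => hy⟩
    · exact ⟨0, fun h => absurd h hd⟩
  choose x hx using hx
  choose y hy using hy
  have hxe : ∀ᶠ t in 𝓝 t₀, rootPoly (x t) = monicPoly (u t) :=
    huv.mono fun t ht => (hx t (Dvd.intro _ ht.symm)).symm
  have hye : ∀ᶠ t in 𝓝 t₀, rootPoly (y t) = monicPoly (v t) :=
    huv.mono fun t ht => (hy t (Dvd.intro_left _ ht.symm)).symm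
  refine ⟨S.card, Sᶜ.card, hab, by omega, by omega, x, y,
    (analyticCoeffs_monicPoly hu).congr hxe, (analyticCoeffs_monicPoly hv).congr hye, ?_⟩
  filter_upwards [huv, hxe, hye] with t h1 h2 h3
  rw [h1, h2, h3]

/-- A one-parameter family of monic polynomials with real roots and analytic coefficients has
analytic roots locally. -/
theorem exists_analytic_roots_at (n : ℕ) (r : ℝ → Fin n → ℝ) (t₀ : ℝ)
    (h : AnalyticCoeffs (fun t => rootPoly (r t)) t₀) :
    ∃ l : ℝ → Fin n → ℝ, ContDiffAt ℝ ω l t₀ ∧ ∀ᶠ t in 𝓝 t₀, rootPoly (r t) = rootPoly (l t) := by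
  induction n using Nat.strong_induction_on with
  | _ n ih =>
    rcases Nat.eq_zero_or_pos n with rfl | hn
    · exact ⟨fun _ => 0, contDiffAt_const, Eventually.of_forall fun t => by simp [rootPoly]⟩
    -- Shift the roots by their mean `c`.
    set c : ℝ → ℝ := fun t => (∑ i, r t i) / n with hc
    have hca : ContDiffAt ℝ ω c t₀ := (analyticAt_sum_roots h).div_const _
    have hs : AnalyticCoeffs (fun t => rootPoly fun i => r t i - c t) t₀ := by
      simp only [rootPoly_add_const]
      exact h.comp (fun t => (natDegree_rootPoly _).le)
        ((AnalyticCoeffs.const X).add (AnalyticCoeffs.C hca))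
    have hs0 (t : ℝ) : ∑ i, (r t i - c t) = 0 := by
      have : (n : ℝ) ≠ 0 := by exact_mod_cast hn.ne'
      simp only [hc, Finset.sum_sub_distrib, Finset.sum_const, Finset.card_univ, Fintype.card_fin,
        nsmul_eq_mul]
      field_simp
      ring
    by_cases hz : ∀ᶠ t in 𝓝 t₀, ∑ i, (r t i - c t) ^ 2 = 0
    · refine ⟨fun t _ => c t, contDiffAt_pi.2 fun _ => hca, hz.mono fun t ht => ?_⟩
      have h1 := (Finset.sum_eq_zero_iff_of_nonneg fun i _ => sq_nonneg (r t i - c t)).1 ht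
      congr 1
      funext i
      exact sub_eq_zero.1 (pow_eq_zero_iff two_ne_zero |>.1 (h1 i (Finset.mem_univ i)))
    obtain ⟨k, ρ, hρ, hρne, hρr⟩ := exists_scaled_roots hs hs0 hz
    obtain ⟨a, b, hab, han, hbn, x, y, hx, hy, hxy⟩ := exists_split_roots hρ hρne
    obtain ⟨x', hx', hxx'⟩ := ih a han x hx
    obtain ⟨y', hy', hyy'⟩ := ih b hbn y hy
    set l : ℝ → Fin n → ℝ := fun t i => Fin.append (x' t) (y' t) (Fin.cast hab i) with hl
    have hla : ContDiffAt ℝ ω l t₀ := by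
      refine contDiffAt_pi.2 fun i => ?_
      simp only [hl]
      generalize Fin.cast hab i = j
      refine Fin.addCases (fun j => ?_) (fun j => ?_) j
      · simpa using contDiffAt_pi.1 hx' j
      · simpa using contDiffAt_pi.1 hy' j
    have hm : ContDiffAt ℝ ω (fun t i => (t - t₀) ^ k * l t i + c t) t₀ :=
      contDiffAt_pi.2 fun i =>
        (((contDiffAt_id.sub contDiffAt_const).pow _).mul (contDiffAt_pi.1 hla i)).add hca
    refine ⟨_, hm, AnalyticCoeffs.eventually_eq h (analyticCoeffs_rootPoly hm)
      (fun t => (natDegree_rootPoly _).le) (fun t => (natDegree_rootPoly _).le) ?_⟩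
    filter_upwards [hρr, (hxy.and (hxx'.and hyy')).filter_mono nhdsWithin_le_nhds]
      with t h1 ⟨h2, h3, h4⟩
    have h5 : rootPoly (ρ t) = rootPoly (l t) := by rw [h2, h3, h4, rootPoly_append]
    obtain ⟨σ, hσ⟩ := exists_perm_of_rootPoly_eq h5
    rw [← rootPoly_comp_perm (fun i => (t - t₀) ^ k * l t i + c t) σ]
    congr 1
    funext i
    have h6 := congrFun h1 i
    rw [hσ] at h6
    simp only [Function.comp_apply] at h6 ⊢
    linarith

/-! ### Analytic continuation along the real line -/

theorem eventually_contDiffAt_omega {E : Type*} [NormedAddCommGroup E] [NormedSpace ℝ E]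
    [CompleteSpace E] {f : ℝ → E} {y : ℝ} (h : ContDiffAt ℝ ω f y) :
    ∀ᶠ z in 𝓝 y, ContDiffAt ℝ ω f z :=
  h.analyticAt.eventually_analyticAt.mono fun _ hz => hz.contDiffAt

/-- Analytic continuation on an interval `[-R, R]`: if all germs of solutions extend to balls of
a radius that is locally uniform in the base point, then a germ at `0` extends to `[-R, R]`. -/
theorem exists_extension_Icc {E : Type*} {Sol : (ℝ → E) → ℝ → Prop}
    (hcongr : ∀ f g y, f =ᶠ[𝓝 y] g → Sol f y → Sol g y)
    (hext : ∀ x, ∃ ε > 0, ∀ y ∈ Metric.ball x ε, ∀ f, Sol f y →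
      ∃ g, (∀ z ∈ Metric.ball x ε, Sol g z) ∧ g =ᶠ[𝓝 y] f)
    {f : ℝ → E} (hf : Sol f 0) (R : ℝ) :
    ∃ g, (∀ z ∈ Set.Icc (-R) R, Sol g z) ∧ g =ᶠ[𝓝 0] f := by
  choose ε hε hext using hext
  obtain ⟨δ, hδ, hcov⟩ := lebesgue_number_lemma_of_metric (isCompact_Icc (a := -R) (b := R))
    (c := fun x => Metric.ball x (ε x)) (fun x => Metric.isOpen_ball)
    (fun x _ => Set.mem_iUnion.2 ⟨x, Metric.mem_ball_self (hε x)⟩)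
  have hstep : ∀ y ∈ Set.Icc (-R) R, ∀ f, Sol f y →
      ∃ g, (∀ z ∈ Metric.ball y δ, Sol g z) ∧ g =ᶠ[𝓝 y] f := by
    intro y hy f hf
    obtain ⟨x, hx⟩ := hcov y hy
    obtain ⟨g, hg, hgf⟩ := hext x y (hx (Metric.mem_ball_self hδ)) f hf
    exact ⟨g, fun z hz => hg z (hx hz), hgf⟩
  have hind : ∀ n : ℕ, ∃ g, (∀ z ∈ Set.Icc (-R) R, |z| ≤ n * (δ / 2) → Sol g z) ∧
      g =ᶠ[𝓝 0] f := by
    intro n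
    induction n with
    | zero =>
      refine ⟨f, fun z _ hz => ?_, EventuallyEq.rfl⟩
      have : z = 0 := abs_eq_zero.1 (le_antisymm (by simpa using hz) (abs_nonneg z))
      exact this ▸ hf
    | succ n ih =>
      obtain ⟨g, hg, hgf⟩ := ih
      set a : ℝ := n * (δ / 2) with ha
      have ha0 : 0 ≤ a := by positivity
      rcases lt_or_ge R a with hRa | haR
      · exact ⟨g, fun z hz _ => hg z hz ((abs_le.2 hz).trans hRa.le), hgf⟩
      obtain ⟨p, hp, hpg⟩ := hstep a ⟨by linarith, haR⟩ g
        (hg a ⟨by linarith, haR⟩ (abs_of_nonneg ha0).le)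
      obtain ⟨m, hm, hmg⟩ := hstep (-a) ⟨by linarith, by linarith⟩ g
        (hg (-a) ⟨by linarith, by linarith⟩ (by rw [abs_neg, abs_of_nonneg ha0]))
      set k : ℝ → E := fun z => if z < -a then m z else if z ≤ a then g z else p z with hk
      have hkp {z : ℝ} (hz : a < z) : k z = p z := by
        simp only [hk]
        rw [if_neg (by linarith), if_neg (by linarith)]
      have hkm {z : ℝ} (hz : z < -a) : k z = m z := by
        simp only [hk]
        rw [if_pos hz]
      have hkg {z : ℝ} (hz : z ∈ Set.Icc (-a) a) : k =ᶠ[𝓝 z] g := by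
        have h1 : ∀ᶠ w in 𝓝 z, a < w → p w = g w := by
          rcases hz.2.lt_or_eq with h | h
          · filter_upwards [eventually_lt_nhds h] with w hw hw'
            exact absurd hw (by linarith)
          · subst h
            exact hpg.mono fun w hw _ => hw
        have h2 : ∀ᶠ w in 𝓝 z, w < -a → m w = g w := by
          rcases hz.1.lt_or_eq with h | h
          · filter_upwards [eventually_gt_nhds h] with w hw hw'
            exact absurd hw (by linarith)
          · subst h
            exact hmg.mono fun w hw _ => hw
        filter_upwards [h1, h2] with w h1 h2
        rcases lt_or_ge w (-a) with hw | hw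
        · rw [hkm hw, h2 hw]
        rcases lt_or_ge a w with hw' | hw'
        · rw [hkp hw', h1 hw']
        · simp only [hk]
          rw [if_neg (by linarith), if_pos hw']
      refine ⟨k, fun z hz hzn => ?_, (hkg ⟨by linarith, ha0⟩).trans hgf⟩
      have hzn' : |z| ≤ a + δ / 2 := by
        refine hzn.trans (le_of_eq ?_)
        rw [ha]
        push_cast
        ring
      obtain ⟨hz1, hz2⟩ := abs_le.1 hzn'
      rcases lt_or_ge z (-a) with hza | hza
      · refine hcongr m k z ?_ (hm z ?_)
        · exact (eventually_lt_nhds hza).mono fun w hw => (hkm hw).symm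
        · rw [Metric.mem_ball, Real.dist_eq, abs_lt]
          constructor <;> linarith
      rcases lt_or_ge a z with hza' | hza'
      · refine hcongr p k z ?_ (hp z ?_)
        · exact (eventually_gt_nhds hza').mono fun w hw => (hkp hw).symm
        · rw [Metric.mem_ball, Real.dist_eq, abs_lt]
          constructor <;> linarith
      · exact hcongr g k z (hkg ⟨hza, hza'⟩).symm (hg z hz (abs_le.2 ⟨hza, hza'⟩))
  obtain ⟨n, hn⟩ := exists_nat_ge (R / (δ / 2))
  obtain ⟨g, hg, hgf⟩ := hind n
  refine ⟨g, fun z hz => hg z hz ((abs_le.2 hz).trans ?_), hgf⟩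
  rwa [div_le_iff₀ (by positivity)] at hn

/-- Analytic continuation along the real line: if all germs of analytic solutions extend to balls
of a radius that is locally uniform in the base point, then a germ at `0` extends to `ℝ`. -/
theorem exists_global_extension {E : Type*} [NormedAddCommGroup E] [NormedSpace ℝ E]
    {Sol : (ℝ → E) → ℝ → Prop} (han : ∀ f y, Sol f y → ContDiffAt ℝ ω f y)
    (hcongr : ∀ f g y, f =ᶠ[𝓝 y] g → Sol f y → Sol g y)
    (hext : ∀ x, ∃ ε > 0, ∀ y ∈ Metric.ball x ε, ∀ f, Sol f y →
      ∃ g, (∀ z ∈ Metric.ball x ε, Sol g z) ∧ g =ᶠ[𝓝 y] f)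
    {f : ℝ → E} (hf : Sol f 0) : ∃ g, ∀ z, Sol g z := by
  choose g hg hgf using fun n : ℕ => exists_extension_Icc hcongr hext hf n
  have huniq {m n : ℕ} (hmn : m ≤ n) : Set.EqOn (g m) (g n) (Set.Icc (-m : ℝ) m) := by
    have hsub : Set.Icc (-m : ℝ) m ⊆ Set.Icc (-n : ℝ) n := by
      have : (m : ℝ) ≤ n := by exact_mod_cast hmn
      exact Set.Icc_subset_Icc (by linarith) this
    refine AnalyticOnNhd.eqOn_of_preconnected_of_eventuallyEq (𝕜 := ℝ) (z₀ := 0)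
      (fun z hz => (han _ _ (hg m z hz)).analyticAt)
      (fun z hz => (han _ _ (hg n z (hsub hz))).analyticAt) isPreconnected_Icc
      (by simp) ((hgf m).trans (hgf n).symm)
  refine ⟨fun t : ℝ => g ⌈|t|⌉₊ t, fun z => ?_⟩
  obtain ⟨N, hN⟩ := exists_nat_gt |z|
  refine hcongr (g N) _ z ?_ (hg N z (abs_le.1 hN.le))
  have hlt : ∀ᶠ w in 𝓝 z, |w| < (N : ℝ) := (continuous_abs.continuousAt).eventually_lt_const hN
  filter_upwards [hlt] with w hw
  exact (huniq (Nat.ceil_le.2 hw.le) (abs_le.1 (Nat.le_ceil _))).symm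

/-- A one-parameter family of monic polynomials with real roots and analytic coefficients has
analytic roots, defined on all of `ℝ`. -/
theorem exists_analytic_roots {n : ℕ} {r : ℝ → Fin n → ℝ}
    (h : ∀ t, AnalyticCoeffs (fun t => rootPoly (r t)) t) :
    ∃ l : ℝ → Fin n → ℝ, (∀ t, ContDiffAt ℝ ω l t) ∧ ∀ t, rootPoly (r t) = rootPoly (l t) := by
  obtain ⟨l₀, hl₀, hrl₀⟩ := exists_analytic_roots_at n r 0 (h 0)
  suffices hext : ∃ l : ℝ → Fin n → ℝ, ∀ y, ContDiffAt ℝ ω l y ∧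
      ∀ᶠ t in 𝓝 y, rootPoly (r t) = rootPoly (l t) by
    obtain ⟨l, hl⟩ := hext
    exact ⟨l, fun t => (hl t).1, fun t => (hl t).2.self_of_nhds⟩
  refine exists_global_extension
    (Sol := fun f y => ContDiffAt ℝ ω f y ∧ ∀ᶠ t in 𝓝 y, rootPoly (r t) = rootPoly (f t))
    (fun f y h => h.1)
    (fun f g y hfg hf => ⟨hf.1.congr_of_eventuallyEq hfg.symm, by
      filter_upwards [hfg, hf.2] with t h1 h2
      rw [← h1, h2]⟩)
    (fun x => ?_) ⟨hl₀, hrl₀⟩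
  obtain ⟨l, hl, hrl⟩ := exists_analytic_roots_at n r x (h x)
  obtain ⟨ε, hε, hball⟩ := Metric.eventually_nhds_iff_ball.1
    ((eventually_contDiffAt_omega hl).and hrl.eventually_nhds)
  refine ⟨ε, hε, fun y hy f hf => ?_⟩
  -- Near `y`, the tuple `f` is a permutation of `l`; since there are finitely many permutations,
  -- one of them works at points accumulating at `y`, hence near `y`.
  obtain ⟨σ, hσ⟩ : ∃ σ : Equiv.Perm (Fin n), ∃ᶠ t in 𝓝[≠] y, f t = l t ∘ σ := by
    by_contra! hno
    have h1 : ∀ᶠ t in 𝓝[≠] y, ∀ σ : Equiv.Perm (Fin n), ¬ f t = l t ∘ σ :=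
      eventually_all.2 hno
    have h2 : ∀ᶠ t in 𝓝[≠] y, rootPoly (f t) = rootPoly (l t) := by
      refine Eventually.filter_mono nhdsWithin_le_nhds ?_
      filter_upwards [hf.2, (hball y hy).2] with t h3 h4
      rw [← h3, h4]
    obtain ⟨t, h3, h4⟩ := (h1.and h2).exists
    obtain ⟨σ, hσ⟩ := exists_perm_of_rootPoly_eq h4
    exact h3 σ hσ
  have hlσ {z : ℝ} (hz : z ∈ Metric.ball x ε) : ContDiffAt ℝ ω (fun t => l t ∘ σ) z :=
    contDiffAt_pi.2 fun i => contDiffAt_pi.1 (hball z hz).1 (σ i)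
  refine ⟨fun t => l t ∘ σ, fun z hz => ⟨hlσ hz, ?_⟩, ?_⟩
  · simpa only [rootPoly_comp_perm] using (hball z hz).2
  · exact (((hf.1.analyticAt).frequently_eq_iff_eventually_eq (hlσ hy).analyticAt).1 hσ).mono
      fun t ht => ht.symm

/-- An analytic curve of vectors that does not vanish identically is a multiple of an analytic curve
of unit vectors: locally this is achieved by cancelling a power of `t - t₀` and normalizing, and the
result is unique up to a sign. -/
theorem exists_analytic_unit_vector {E : Type*} [NormedAddCommGroup E] [InnerProductSpace ℂ E]
    [CompleteSpace E] {x : ℝ → E} (hx : ∀ t, ContDiffAt ℝ ω x t) (hne : ∃ t, x t ≠ 0) :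
    ∃ v : ℝ → E, (∀ t, ContDiffAt ℝ ω v t) ∧ (∀ t, ‖v t‖ = 1) ∧
      ∀ t, ∃ c : ℝ, x t = c • v t := by
  have hnz (t₀ : ℝ) : ¬ ∀ᶠ t in 𝓝 t₀, x t = 0 := by
    intro hz
    obtain ⟨t, ht⟩ := hne
    exact ht (AnalyticOnNhd.eqOn_zero_of_preconnected_of_eventuallyEq_zero (𝕜 := ℝ)
      (fun z _ => (hx z).analyticAt) isPreconnected_univ (Set.mem_univ t₀) hz (Set.mem_univ t))
  have hloc (t₀ : ℝ) : ∃ ε > 0, ∃ v : ℝ → E, ∀ z ∈ Metric.ball t₀ ε, ContDiffAt ℝ ω v z ∧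
      ∀ᶠ t in 𝓝 z, ‖v t‖ = 1 ∧ ∃ c : ℝ, x t = c • v t := by
    obtain ⟨m, w, hw, hw0, hxw⟩ :=
      (hx t₀).analyticAt.exists_eventuallyEq_pow_smul_nonzero_iff.2 (hnz t₀)
    have hv : ContDiffAt ℝ ω (fun t => ‖w t‖⁻¹ • w t) t₀ :=
      ((hw.contDiffAt.norm ℂ hw0).inv (norm_ne_zero_iff.2 hw0)).smul hw.contDiffAt
    have hev : ∀ᶠ t in 𝓝 t₀, ‖‖w t‖⁻¹ • w t‖ = 1 ∧ ∃ c : ℝ, x t = c • (‖w t‖⁻¹ • w t) := by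
      filter_upwards [hxw, hw.continuousAt.eventually_ne hw0] with t h1 h2
      have h3 : ‖w t‖ ≠ 0 := norm_ne_zero_iff.2 h2
      refine ⟨by rw [norm_smul, norm_inv, norm_norm, inv_mul_cancel₀ h3],
        (t - t₀) ^ m * ‖w t‖, ?_⟩
      rw [h1, smul_smul, mul_assoc, mul_inv_cancel₀ h3, mul_one]
    obtain ⟨ε, hε, hball⟩ := Metric.eventually_nhds_iff_ball.1
      ((eventually_contDiffAt_omega hv).and hev.eventually_nhds)
    exact ⟨ε, hε, _, hball⟩
  obtain ⟨ε₀, hε₀, v₀, hv₀⟩ := hloc 0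
  suffices hext : ∃ v : ℝ → E, ∀ y, ContDiffAt ℝ ω v y ∧
      ∀ᶠ t in 𝓝 y, ‖v t‖ = 1 ∧ ∃ c : ℝ, x t = c • v t by
    obtain ⟨v, hv⟩ := hext
    exact ⟨v, fun t => (hv t).1, fun t => (hv t).2.self_of_nhds.1,
      fun t => (hv t).2.self_of_nhds.2⟩
  refine exists_global_extension
    (Sol := fun f y => ContDiffAt ℝ ω f y ∧ ∀ᶠ t in 𝓝 y, ‖f t‖ = 1 ∧ ∃ c : ℝ, x t = c • f t)
    (fun f y h => h.1)
    (fun f g y hfg hf => ⟨hf.1.congr_of_eventuallyEq hfg.symm, by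
      filter_upwards [hfg, hf.2] with t h1 h2
      rwa [← h1]⟩)
    (fun t₀ => ?_) (hv₀ 0 (Metric.mem_ball_self hε₀))
  obtain ⟨ε, hε, v, hv⟩ := hloc t₀
  refine ⟨ε, hε, fun y hy f hf => ?_⟩
  have hsign : ∀ᶠ t in 𝓝[≠] y, f t = v t ∨ f t = -v t := by
    have hxne : ∀ᶠ t in 𝓝[≠] y, x t ≠ 0 :=
      ((hx y).analyticAt.eventually_eq_zero_or_eventually_ne_zero).resolve_left (hnz y)
    filter_upwards [hxne, hf.2.filter_mono nhdsWithin_le_nhds,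
      (hv y hy).2.filter_mono nhdsWithin_le_nhds] with t h1 ⟨h2, c, h3⟩ ⟨h4, c', h5⟩
    have hc : c ≠ 0 := by
      rintro rfl
      exact h1 (by rw [h3, zero_smul])
    have hcc : |c| = |c'| := by
      have := congrArg norm (h3.symm.trans h5)
      simpa [norm_smul, h2, h4] using this
    have h6 := h3.symm.trans h5
    rcases abs_eq_abs.1 hcc with rfl | rfl
    · exact Or.inl (smul_right_injective E hc h6)
    · refine Or.inr (smul_right_injective E hc ?_)
      simp only [neg_smul] at h6
      simp only [smul_neg, ← h6, neg_smul, neg_neg]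
  rcases frequently_or_distrib.1 hsign.frequently with h1 | h1
  · exact ⟨v, hv, ((hf.1.analyticAt.frequently_eq_iff_eventually_eq
      (hv y hy).1.analyticAt).1 h1).mono fun t ht => ht.symm⟩
  · refine ⟨fun t => -v t, fun z hz => ⟨(hv z hz).1.neg, (hv z hz).2.mono ?_⟩,
      ((hf.1.analyticAt.frequently_eq_iff_eventually_eq
        (hv y hy).1.neg.analyticAt).1 h1).mono fun t ht => ht.symm⟩
    rintro t ⟨h2, c, h3⟩
    exact ⟨by rw [norm_neg, h2], -c, by rw [h3, smul_neg, neg_smul, neg_neg]⟩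

/-! ### Analytic eigenvectors of analytic families of hermitian matrices -/

/-- The ring of analytic functions `ℝ → ℂ`. -/
def analyticRing : Subring (ℝ → ℂ) where
  carrier := {f | ∀ t, ContDiffAt ℝ ω f t}
  mul_mem' hf hg t := (hf t).mul (hg t)
  one_mem' _ := contDiffAt_const
  add_mem' hf hg t := (hf t).add (hg t)
  zero_mem' _ := contDiffAt_const
  neg_mem' hf t := (hf t).neg

instance : IsDomain analyticRing := by
  have : NoZeroDivisors analyticRing := by
    refine ⟨fun {f g} hfg => ?_⟩
    have h := AnalyticOnNhd.eq_zero_or_eq_zero_of_mul_eq_zero (𝕜 := ℝ) (U := Set.univ)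
      (f := f.1) (g := g.1) (fun t _ => (f.2 t).analyticAt) (fun t _ => (g.2 t).analyticAt)
      (fun t _ => congrFun (congrArg Subtype.val hfg) t) isPreconnected_univ
    exact h.imp (fun h => Subtype.ext (funext fun t => h t (Set.mem_univ t)))
      (fun h => Subtype.ext (funext fun t => h t (Set.mem_univ t)))
  exact NoZeroDivisors.to_isDomain _

/-- Evaluation of analytic functions at a point. -/
def evalAt (t : ℝ) : analyticRing →+* ℂ := (Pi.evalRingHom (fun _ : ℝ => ℂ) t).comp
  analyticRing.subtype

theorem analyticRing_ext {f g : analyticRing} (h : ∀ t, evalAt t f = evalAt t g) : f = g :=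
  Subtype.ext (funext h)

variable {d : ℕ}

/-- The analytic eigenvalues of an analytic family of hermitian matrices. -/
theorem exists_analytic_eigenvalues {H : ℝ → Matrix (Fin d) (Fin d) ℂ}
    (hH : ∀ i j t, ContDiffAt ℝ ω (fun t => H t i j) t) (hh : ∀ t, (H t).IsHermitian) :
    ∃ l : ℝ → Fin d → ℝ, (∀ t, ContDiffAt ℝ ω l t) ∧
      ∀ t, (H t).charpoly = ∏ i, (X - C (l t i : ℂ)) := by
  let HR : Matrix (Fin d) (Fin d) analyticRing := fun i j => ⟨fun t => H t i j, hH i j⟩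
  have hHR (t : ℝ) : (H t).charpoly = HR.charpoly.map (evalAt t) := by
    rw [← Matrix.charpoly_map]
    rfl
  have hmap (r : Fin d → ℝ) :
      (rootPoly r).map Complex.ofRealHom = ∏ i, (X - C (r i : ℂ)) := by
    simp [rootPoly, Polynomial.map_prod]
  have heig (t : ℝ) : (H t).charpoly = (rootPoly (hh t).eigenvalues).map Complex.ofRealHom := by
    rw [(hh t).charpoly_eq, hmap]
    rfl
  have hr : ∀ t, AnalyticCoeffs (fun t => rootPoly (hh t).eigenvalues) t := by
    intro t i
    have h1 (s : ℝ) : (rootPoly (hh s).eigenvalues).coeff i =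
        Complex.reCLM ((HR.charpoly.coeff i).1 s) := by
      have h2 := congrArg (fun p => p.coeff i) ((heig s).symm.trans (hHR s))
      simp only [coeff_map] at h2
      exact congrArg Complex.re h2
    simp only [h1]
    exact Complex.reCLM.contDiff.contDiffAt.comp t ((HR.charpoly.coeff i).2 t)
  obtain ⟨l, hl, hrl⟩ := exists_analytic_roots hr
  exact ⟨l, hl, fun t => by rw [heig t, hrl t, hmap]⟩

/-- Fewer than `d` orthonormal eigenvectors of a hermitian matrix can be supplemented by an
eigenvector in their orthogonal complement. -/
theorem exists_eigenvector_orthogonal {M : Matrix (Fin d) (Fin d) ℂ} (hM : M.IsHermitian) {m : ℕ}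
    (hm : m < d) {v : Fin m → EuclideanSpace ℂ (Fin d)} (hv : Orthonormal ℂ v) {μ : Fin m → ℝ}
    (hμ : ∀ k, Matrix.toEuclideanLin M (v k) = (μ k : ℂ) • v k) :
    ∃ (ν : ℂ) (x : EuclideanSpace ℂ (Fin d)), x ≠ 0 ∧ Matrix.toEuclideanLin M x = ν • x ∧
      ∀ k, inner ℂ (v k) x = 0 := by
  set T := Matrix.toEuclideanLin M with hT
  have hsym : T.IsSymmetric := Matrix.isSymmetric_toEuclideanLin_iff.2 hM
  set V := (Submodule.span ℂ (Set.range v))ᗮ with hV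
  have hmem {x : EuclideanSpace ℂ (Fin d)} : x ∈ V ↔ ∀ k, inner ℂ (v k) x = 0 := by
    rw [hV, Submodule.mem_orthogonal]
    refine ⟨fun h k => h _ (Submodule.subset_span ⟨k, rfl⟩), fun h u hu => ?_⟩
    induction hu using Submodule.span_induction with
    | mem u hu => obtain ⟨k, rfl⟩ := hu; exact h k
    | zero => simp
    | add u w _ _ hu hw => rw [inner_add_left, hu, hw, add_zero]
    | smul c u _ hu => rw [inner_smul_left, hu, mul_zero]
  have hinv : ∀ x ∈ V, T x ∈ V := by
    intro x hx
    refine hmem.2 fun k => ?_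
    rw [← hsym (v k) x, hμ k, inner_smul_left, hmem.1 hx k, mul_zero]
  have hnt : Nontrivial V := by
    refine Module.finrank_pos_iff (R := ℂ).1 ?_
    have h1 := Submodule.finrank_add_finrank_orthogonal (Submodule.span ℂ (Set.range v))
    rw [finrank_span_eq_card hv.linearIndependent, finrank_euclideanSpace, Fintype.card_fin,
      Fintype.card_fin] at h1
    rw [hV]
    omega
  obtain ⟨ν, hν⟩ := Module.End.exists_eigenvalue (T.restrict hinv)
  obtain ⟨x, hx⟩ := hν.exists_hasEigenvector
  refine ⟨ν, x, fun h => hx.2 (Subtype.ext h), ?_, hmem.1 x.2⟩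
  exact congrArg Subtype.val hx.apply_eq_smul

/-- The positive semidefinite matrix `(M - l) ^ 2 + ∑ k, v k (v k)*`, whose kernel consists of the
vectors of the eigenspace of the hermitian matrix `M` for `l` that are orthogonal to all `v k`. -/
theorem mulVec_sq_add_sum_eq_zero_iff {M : Matrix (Fin d) (Fin d) ℂ} (hM : M.IsHermitian) {m : ℕ}
    (v : Fin m → EuclideanSpace ℂ (Fin d)) (l : ℝ) (x : EuclideanSpace ℂ (Fin d)) :
    Matrix.mulVec ((M - Matrix.scalar (Fin d) (l : ℂ)) ^ 2 +
        ∑ k, Matrix.vecMulVec (v k).ofLp (star (v k).ofLp)) x.ofLp = 0 ↔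
      Matrix.toEuclideanLin M x = (l : ℂ) • x ∧ ∀ k, inner ℂ (v k) x = 0 := by
  set N := M - Matrix.scalar (Fin d) (l : ℂ) with hN
  have hNx (y : EuclideanSpace ℂ (Fin d)) :
      Matrix.toEuclideanLin N y = Matrix.toEuclideanLin M y - (l : ℂ) • y := by
    ext i
    simp [hN, Matrix.toLpLin_apply, Matrix.scalar_apply]
  have hNsym : (Matrix.toEuclideanLin N).IsSymmetric := by
    have h1 := Matrix.isSymmetric_toEuclideanLin_iff.2 hM
    intro y z
    simp only [hNx, inner_sub_left, inner_sub_right, inner_smul_left, inner_smul_right, h1 y z,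
      Complex.conj_ofReal]
  have hsum : WithLp.toLp 2 (Matrix.mulVec (N ^ 2 +
        ∑ k, Matrix.vecMulVec (v k).ofLp (star (v k).ofLp)) x.ofLp) =
      Matrix.toEuclideanLin N (Matrix.toEuclideanLin N x) + ∑ k, inner ℂ (v k) x • v k := by
    ext i
    simp only [Matrix.add_mulVec, Matrix.sum_mulVec, pow_two, ← Matrix.mulVec_mulVec,
      Matrix.vecMulVec_mulVec, Matrix.toLpLin_apply, PiLp.add_apply, Pi.add_apply,
      WithLp.ofLp_sum, Finset.sum_apply, smul_eq_mul, Pi.smul_apply,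
      MulOpposite.smul_eq_mul_unop, MulOpposite.unop_op, EuclideanSpace.inner_eq_star_dotProduct,
      WithLp.ofLp_smul]
    congr 1
    refine Finset.sum_congr rfl fun k _ => ?_
    rw [dotProduct_comm, mul_comm]
  constructor
  · intro h
    rw [h] at hsum
    have h1 := congrArg (fun y => RCLike.re (inner ℂ x y)) hsum
    simp only [inner_add_right, inner_sum, inner_smul_right] at h1
    rw [← hNsym, WithLp.toLp_zero, inner_zero_right, map_zero, map_add, map_sum,
      inner_self_eq_norm_sq] at h1
    have h2 (k : Fin m) : RCLike.re (inner ℂ (v k) x * inner ℂ x (v k)) =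
        ‖inner ℂ (v k) x‖ ^ 2 := by
      rw [← inner_conj_symm x (v k), RCLike.mul_conj]
      norm_cast
    simp only [h2] at h1
    have h3 : 0 ≤ ∑ k, ‖inner ℂ (v k) x‖ ^ 2 := Finset.sum_nonneg fun _ _ => sq_nonneg _
    have h4 : ‖Matrix.toEuclideanLin N x‖ ^ 2 = 0 := by
      linarith [sq_nonneg ‖Matrix.toEuclideanLin N x‖]
    have h5 : ∑ k, ‖inner ℂ (v k) x‖ ^ 2 = 0 := by linarith
    refine ⟨?_, fun k => ?_⟩
    · rw [← sub_eq_zero, ← hNx]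
      exact norm_eq_zero.1 (pow_eq_zero_iff two_ne_zero |>.1 h4)
    · have := (Finset.sum_eq_zero_iff_of_nonneg fun _ _ => sq_nonneg _).1 h5 k (Finset.mem_univ k)
      exact norm_eq_zero.1 (pow_eq_zero_iff two_ne_zero |>.1 this)
  · rintro ⟨h1, h2⟩
    have h3 : Matrix.toEuclideanLin N x = 0 := by rw [hNx, h1, sub_self]
    simp only [h3, h2, map_zero, zero_smul, Finset.sum_const_zero, add_zero] at hsum
    exact congrArg WithLp.ofLp hsum

theorem contDiffAt_euclidean_apply {x : ℝ → EuclideanSpace ℂ (Fin d)} {t : ℝ}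
    (hx : ContDiffAt ℝ ω x t) (i : Fin d) : ContDiffAt ℝ ω (fun t => x t i) t :=
  (contDiffAt_piLp 2).1 hx i

/-- **Rellich's theorem**: an analytic family of hermitian matrices, defined on `ℝ`, has analytic
orthonormal eigenvectors. A further eigenvector is found by linear algebra over the integral domain
of analytic functions: finitely many matrices over this domain have a singular product, hence one of
them has a nontrivial kernel. -/
theorem exists_analytic_orthonormal_eigenvectors {H : ℝ → Matrix (Fin d) (Fin d) ℂ}
    (hH : ∀ i j t, ContDiffAt ℝ ω (fun t => H t i j) t) (hh : ∀ t, (H t).IsHermitian) {m : ℕ}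
    (hm : m ≤ d) :
    ∃ ψ : Fin m → ℝ → EuclideanSpace ℂ (Fin d), (∀ k t, ContDiffAt ℝ ω (ψ k) t) ∧
      (∀ t, Orthonormal ℂ fun k => ψ k t) ∧
      ∀ k, ∃ μ : ℝ → ℝ, ∀ t, Matrix.toEuclideanLin (H t) (ψ k t) = (μ t : ℂ) • ψ k t := by
  obtain ⟨l, hl, hlH⟩ := exists_analytic_eigenvalues hH hh
  induction m with
  | zero => exact ⟨fun k => k.elim0, fun k => k.elim0, fun t => ⟨fun k => k.elim0,
      fun k => k.elim0⟩, fun k => k.elim0⟩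
  | succ m ih =>
    obtain ⟨ψ, hψ, hon, heig⟩ := ih (Nat.le_of_succ_le hm)
    choose μ hμ using heig
    let M (j : Fin d) (t : ℝ) : Matrix (Fin d) (Fin d) ℂ :=
      (H t - Matrix.scalar (Fin d) (l t j : ℂ)) ^ 2 +
        ∑ k, Matrix.vecMulVec (ψ k t).ofLp (star (ψ k t).ofLp)
    have hlC (j : Fin d) (t : ℝ) : ContDiffAt ℝ ω (fun t => (l t j : ℂ)) t :=
      Complex.ofRealCLM.contDiff.contDiffAt.comp t (contDiffAt_pi.1 (hl t) j)
    have hM (j a b : Fin d) (t : ℝ) : ContDiffAt ℝ ω (fun t => M j t a b) t := by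
      have hN (a b : Fin d) :
          ContDiffAt ℝ ω (fun t => (H t - Matrix.scalar (Fin d) (l t j : ℂ)) a b) t := by
        simp only [Matrix.sub_apply, Matrix.scalar_apply, Matrix.diagonal_apply]
        refine (hH a b t).sub ?_
        by_cases hab : a = b
        · simpa [hab] using hlC j t
        · simpa [hab] using contDiffAt_const
      have hP (k : Fin m) : ContDiffAt ℝ ω (fun t => ψ k t a * star (ψ k t b)) t :=
        (contDiffAt_euclidean_apply (hψ k t) a).mul
          (Complex.conjCLE.contDiff.contDiffAt.comp t (contDiffAt_euclidean_apply (hψ k t) b))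
      simp only [M, Matrix.add_apply, pow_two, Matrix.mul_apply, Matrix.sum_apply,
        Matrix.vecMulVec_apply, Pi.star_apply]
      exact (ContDiffAt.sum fun c _ => (hN a c).mul (hN c b)).add (ContDiffAt.sum fun k _ => hP k)
    let MR (j : Fin d) : Matrix (Fin d) (Fin d) analyticRing :=
      fun a b => ⟨fun t => M j t a b, hM j a b⟩
    have hdet (j : Fin d) (t : ℝ) : evalAt t (MR j).det = (M j t).det := by
      rw [RingHom.map_det]
      rfl
    have hprod : ∏ j, (MR j).det = 0 := by
      refine analyticRing_ext fun t => ?_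
      obtain ⟨ν, x, hx0, hx, hxψ⟩ := exists_eigenvector_orthogonal (hh t) hm (hon t)
        (μ := fun k => μ k t) (fun k => hμ k t)
      have hν : (H t).charpoly.IsRoot ν := by
        rw [← Matrix.mem_spectrum_iff_isRoot_charpoly, ← Matrix.spectrum_toLpLin 2]
        exact (Module.End.hasEigenvalue_of_hasEigenvector
          (Module.End.hasEigenvector_iff.2 ⟨Module.End.mem_eigenspace_iff.2 hx, hx0⟩)).mem_spectrum
      rw [hlH t, isRoot_prod] at hν
      obtain ⟨j, -, hj⟩ := hν
      have hνj : ν = l t j := root_X_sub_C.1 hj |>.symm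
      rw [hνj] at hx
      have h0 : (M j t).det = 0 := Matrix.exists_mulVec_eq_zero_iff.1 ⟨x.ofLp,
        fun h => hx0 (WithLp.ofLp_injective 2 h),
        (mulVec_sq_add_sum_eq_zero_iff (hh t) _ _ x).2 ⟨hx, hxψ⟩⟩
      rw [map_prod, map_zero]
      exact Finset.prod_eq_zero (Finset.mem_univ j) ((hdet j t).trans h0)
    obtain ⟨j, -, hj⟩ := Finset.prod_eq_zero_iff.1 hprod
    obtain ⟨x, hx0, hx⟩ := Matrix.exists_mulVec_eq_zero_iff.2 hj
    let y (t : ℝ) : EuclideanSpace ℂ (Fin d) := WithLp.toLp 2 fun i => (x i).1 t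
    have hy (t : ℝ) : ContDiffAt ℝ ω y t :=
      (contDiffAt_piLp 2).2 fun i => (x i).2 t
    have hyne : ∃ t, y t ≠ 0 := by
      by_contra! h
      refine hx0 (funext fun i => analyticRing_ext fun t => ?_)
      exact congrFun (congrArg WithLp.ofLp (h t)) i
    have hker (t : ℝ) : Matrix.toEuclideanLin (H t) (y t) = (l t j : ℂ) • y t ∧
        ∀ k, inner ℂ (ψ k t) (y t) = 0 := by
      refine (mulVec_sq_add_sum_eq_zero_iff (hh t) (fun k => ψ k t) (l t j) (y t)).1 ?_
      have h1 := congrArg (fun z => fun i => evalAt t (z i)) hx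
      funext i
      have h2 := congrFun h1 i
      simp only [Matrix.mulVec, dotProduct, map_sum, map_mul, Pi.zero_apply, map_zero] at h2
      exact h2
    obtain ⟨v, hv, hv1, hyv⟩ := exists_analytic_unit_vector hy hyne
    -- The kernel equations pass from `y` to `v` on the dense set where `y` does not vanish.
    have hdense : Dense {t | y t ≠ 0} := by
      refine dense_iff_inter_open.2 fun U hU ⟨t₀, ht₀⟩ => ?_
      by_contra hne
      obtain ⟨t, ht⟩ := hyne
      refine ht (AnalyticOnNhd.eqOn_zero_of_preconnected_of_eventuallyEq_zero (𝕜 := ℝ)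
        (fun z _ => (hy z).analyticAt) isPreconnected_univ (Set.mem_univ t₀) ?_ (Set.mem_univ t))
      filter_upwards [hU.mem_nhds ht₀] with s hs
      by_contra hys
      exact hne ⟨s, hs, hys⟩
    have hvcont : Continuous v := continuous_iff_continuousAt.2 fun t => (hv t).continuousAt
    have hvker {t : ℝ} (ht : y t ≠ 0) : Matrix.toEuclideanLin (H t) (v t) = (l t j : ℂ) • v t ∧
        ∀ k, inner ℂ (ψ k t) (v t) = 0 := by
      obtain ⟨c, hc⟩ := hyv t
      have hc0 : (c : ℂ) ≠ 0 := by
        rintro h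
        rw [Complex.ofReal_eq_zero] at h
        exact ht (by rw [hc, h, zero_smul])
      have hvc : v t = (c : ℂ)⁻¹ • y t := by
        rw [hc, ← Complex.coe_smul, smul_smul, inv_mul_cancel₀ hc0, one_smul]
      rw [hvc]
      refine ⟨?_, fun k => ?_⟩
      · rw [map_smul, (hker t).1, smul_comm]
      · rw [inner_smul_right, (hker t).2 k, mul_zero]
    have hvH (t : ℝ) : Matrix.toEuclideanLin (H t) (v t) = (l t j : ℂ) • v t := by
      have hcont1 : Continuous fun t => Matrix.toEuclideanLin (H t) (v t) := by
        have hHc : Continuous H := continuous_matrix fun a b =>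
          continuous_iff_continuousAt.2 fun t => (hH a b t).continuousAt
        simp only [Matrix.toLpLin_apply]
        exact (PiLp.continuous_toLp 2 _).comp
          (hHc.matrix_mulVec ((PiLp.continuous_ofLp 2 _).comp hvcont))
      have hcont2 : Continuous fun t => (l t j : ℂ) • v t :=
        (continuous_iff_continuousAt.2 fun t => (hlC j t).continuousAt).smul hvcont
      exact congrFun (hcont1.ext_on hdense hcont2 fun t ht => (hvker ht).1) t
    have hvψ (t : ℝ) (k : Fin m) : inner ℂ (ψ k t) (v t) = 0 := by
      have hcont : Continuous fun t => inner ℂ (ψ k t) (v t) :=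
        (continuous_iff_continuousAt.2 fun t => (hψ k t).continuousAt).inner hvcont
      exact congrFun (hcont.ext_on hdense continuous_const fun t ht => (hvker ht).2 k) t
    refine ⟨Fin.snoc ψ v, fun k => ?_, fun t => ?_, fun k => ?_⟩
    · refine Fin.lastCases ?_ (fun k => ?_) k
      · simpa using hv
      · simpa using hψ k
    · constructor
      · refine Fin.lastCases ?_ fun k => ?_
        · simpa using hv1 t
        · simpa using (hon t).1 k
      · intro a b
        refine Fin.lastCases ?_ (fun a => ?_) a <;> refine Fin.lastCases ?_ (fun b => ?_) b
        · simp
        · intro _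
          simpa using inner_eq_zero_symm.1 (hvψ t b)
        · intro _
          simpa using hvψ t a
        · intro hab
          simpa using (hon t).2 fun h => hab (by rw [h])
    · refine Fin.lastCases ?_ (fun k => ?_) k
      · exact ⟨fun t => l t j, fun t => by simpa using hvH t⟩
      · exact ⟨μ k, fun t => by simpa using hμ k t⟩

theorem contDiffAt_rotatedRe (A : Matrix (Fin d) (Fin d) ℂ) (i j : Fin d) (t : ℝ) :
    ContDiffAt ℝ ω (fun t => rotatedRe A t i j) t := by
  have hexp : ContDiffAt ℝ ω (fun t : ℝ => Complex.exp (-(Complex.I * (t : ℂ)))) t :=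
    (contDiffAt_const.mul Complex.ofRealCLM.contDiff.contDiffAt).neg.cexp
  simp only [rotatedRe, realPart_apply_coe, Matrix.smul_apply, Matrix.add_apply, Matrix.star_apply]
  refine ContDiffAt.const_smul _ ((hexp.smul contDiffAt_const).add ?_)
  exact Complex.conjCLE.contDiff.contDiffAt.comp t (hexp.smul contDiffAt_const)

theorem exists_isAnalyticEigenbasis (A : Matrix (Fin d) (Fin d) ℂ) :
    ∃ ψ : Fin d → ℝ → EuclideanSpace ℂ (Fin d), IsAnalyticEigenbasis A ψ := by
  obtain ⟨ψ, hψ, hon, heig⟩ := exists_analytic_orthonormal_eigenvectors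
    (contDiffAt_rotatedRe A) (rotatedRe_isHermitian A) le_rfl
  refine ⟨ψ, fun k t => (hψ k t).analyticAt, hon, fun k t => ?_⟩
  obtain ⟨μ, hμ⟩ := heig k
  exact ⟨μ t, Module.End.hasEigenvector_iff.2 ⟨Module.End.mem_eigenspace_iff.2 (hμ t),
    (hon t).ne_zero k⟩⟩

/-! ### Truncated powers and branching of analytic functions -/

theorem hasDerivAt_max_pow (n : ℕ) (s : ℝ) :
    HasDerivAt (fun s : ℝ => max s 0 ^ (n + 2)) ((n + 2) * max s 0 ^ (n + 1)) s := by
  rcases lt_trichotomy s 0 with hs | rfl | hs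
  · have h1 : (fun s : ℝ => max s 0 ^ (n + 2)) =ᶠ[𝓝 s] fun _ => 0 := by
      filter_upwards [eventually_lt_nhds hs] with t ht
      rw [max_eq_right ht.le, zero_pow (by omega)]
    rw [max_eq_right hs.le, zero_pow (by omega), mul_zero]
    exact (hasDerivAt_const s (0 : ℝ)).congr_of_eventuallyEq h1
  · have h1 : (fun s : ℝ => max s 0 ^ (n + 2)) = fun s => s * max s 0 ^ (n + 1) := by
      funext s
      rcases le_total s 0 with h | h
      · rw [max_eq_right h, zero_pow (by omega), zero_pow (by omega), mul_zero]
      · rw [max_eq_left h, ← pow_succ']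
    rw [h1, max_self, zero_pow (by omega), mul_zero, hasDerivAt_iff_tendsto_slope]
    have h2 : Tendsto (fun s : ℝ => max s 0 ^ (n + 1)) (𝓝[≠] 0) (𝓝 0) := by
      have : ContinuousAt (fun s : ℝ => max s 0 ^ (n + 1)) 0 := by fun_prop
      have h3 := this.tendsto
      simp only [max_self, zero_pow (Nat.succ_ne_zero n)] at h3
      exact h3.mono_left nhdsWithin_le_nhds
    refine h2.congr' ?_
    filter_upwards [self_mem_nhdsWithin] with s hs
    have hs0 : s ≠ 0 := hs
    simp only [slope, vsub_eq_sub, sub_zero, zero_mul, smul_eq_mul]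
    rw [← mul_assoc, inv_mul_cancel₀ hs0, one_mul]
  · have h1 : (fun s : ℝ => max s 0 ^ (n + 2)) =ᶠ[𝓝 s] fun s => s ^ (n + 2) := by
      filter_upwards [eventually_gt_nhds hs] with t ht
      rw [max_eq_left ht.le]
    rw [max_eq_left hs.le]
    have h2 := hasDerivAt_pow (n + 2) s
    push_cast at h2
    exact h2.congr_of_eventuallyEq h1

theorem contDiff_max_pow (n : ℕ) : ContDiff ℝ n (fun s : ℝ => max s 0 ^ (n + 1)) := by
  induction n with
  | zero => exact contDiff_zero.2 (by fun_prop)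
  | succ n ih =>
    rw [Nat.cast_add, Nat.cast_one, contDiff_succ_iff_deriv]
    refine ⟨fun s => (hasDerivAt_max_pow n s).differentiableAt, fun h => by simp at h, ?_⟩
    have : deriv (fun s : ℝ => max s 0 ^ (n + 1 + 1)) =
        fun s => ((n : ℝ) + 2) * max s 0 ^ (n + 1) :=
      funext fun s => (hasDerivAt_max_pow n s).deriv
    rw [this]
    exact contDiff_const.mul ih

theorem not_contDiffAt_max_pow (n : ℕ) :
    ¬ ContDiffAt ℝ ((n + 1 : ℕ) : ℕ∞ω) (fun s : ℝ => max s 0 ^ (n + 1)) 0 := by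
  induction n with
  | zero =>
    intro h
    have h1 : DifferentiableAt ℝ (fun s : ℝ => max s 0 ^ (0 + 1)) 0 :=
      h.differentiableAt (by simp)
    refine not_differentiableAt_abs_zero ?_
    have h2 : (abs : ℝ → ℝ) = fun s => 2 * max s 0 ^ (0 + 1) - s := by
      funext s
      rcases le_total s 0 with h | h
      · rw [max_eq_right h, abs_of_nonpos h]; ring
      · rw [max_eq_left h, abs_of_nonneg h]; ring
    rw [h2]
    exact (h1.const_mul 2).sub differentiableAt_id
  | succ n ih =>
    intro h
    refine ih ?_
    have h1 : ContDiffAt ℝ ((n + 1 : ℕ) : ℕ∞ω) (deriv fun s : ℝ => max s 0 ^ (n + 1 + 1)) 0 :=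
      (h.fderiv_right (m := ((n + 1 : ℕ) : ℕ∞ω)) (by norm_cast)).clm_apply contDiffAt_const
    have h2 : (fun s : ℝ => max s 0 ^ (n + 1)) =
        fun s => ((n : ℝ) + 2)⁻¹ * deriv (fun s : ℝ => max s 0 ^ (n + 1 + 1)) s := by
      funext s
      have h3 : ((n : ℝ) + 2) ≠ 0 := by positivity
      rw [(hasDerivAt_max_pow n s).deriv, ← mul_assoc, inv_mul_cancel₀ h3, one_mul]
    rw [h2]
    exact contDiffAt_const.mul h1

/-- An analytic function plus a truncated power, with an analytic factor that does not vanish, has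
the maximal order of the truncated power. -/
theorem hasMaximalOrder_of_eventually_eq {g f u : ℝ → ℝ} {t₀ : ℝ} {n : ℕ}
    (hf : ContDiffAt ℝ ω f t₀) (hu : ContDiffAt ℝ ω u t₀) (hu0 : u t₀ ≠ 0)
    (hg : ∀ᶠ t in 𝓝 t₀, g t = f t + max (t - t₀) 0 ^ (n + 1) * u t) : HasMaximalOrder g t₀ n := by
  have hsub {m : ℕ∞ω} : ContDiffAt ℝ m (fun t : ℝ => t - t₀) t₀ :=
    contDiffAt_id.sub contDiffAt_const
  constructor
  · refine ContDiffAt.congr_of_eventuallyEq ?_ hg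
    exact (hf.of_le le_top).add (((contDiff_max_pow n).contDiffAt.comp t₀ hsub).mul
      (hu.of_le le_top))
  · intro h
    have h1 : ContDiffAt ℝ ((n + 1 : ℕ) : ℕ∞ω) (fun t => (g t - f t) * (u t)⁻¹) t₀ :=
      (h.sub (hf.of_le le_top)).mul ((hu.of_le le_top).inv hu0)
    have h2 : (fun t => max (t - t₀) 0 ^ (n + 1)) =ᶠ[𝓝 t₀] fun t => (g t - f t) * (u t)⁻¹ := by
      filter_upwards [hg, hu.continuousAt.eventually_ne hu0] with t h3 h4
      rw [h3, add_sub_cancel_left, mul_assoc, mul_inv_cancel₀ h4, mul_one]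
    have h3 := h1.congr_of_eventuallyEq h2
    refine not_contDiffAt_max_pow n ?_
    have h4 : (fun s : ℝ => max s 0 ^ (n + 1)) =
        (fun t => max (t - t₀) 0 ^ (n + 1)) ∘ fun s => s + t₀ := by
      funext s
      simp
    rw [h4]
    refine ContDiffAt.comp 0 ?_ (contDiffAt_id.add contDiffAt_const)
    simpa using h3

/-- The minimum of finitely many analytic functions agrees on one side of a point with one of them;
`F` is the filter of right or left neighborhoods. -/
theorem exists_eventually_eq_of_isMin {ι : Type*} [Finite ι] {f : ι → ℝ → ℝ} {g : ℝ → ℝ} {t₀ : ℝ}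
    {F : Filter ℝ} [F.NeBot] (hF : F ≤ 𝓝 t₀)
    (hpow : ∀ m : ℕ, (∀ᶠ t in F, 0 < (t - t₀) ^ m) ∨ ∀ᶠ t in F, (t - t₀) ^ m < 0)
    (hf : ∀ k, ContDiffAt ℝ ω (f k) t₀) (hle : ∀ k t, g t ≤ f k t)
    (hmem : ∀ t, ∃ k, f k t = g t) :
    ∃ k, f k t₀ = g t₀ ∧ ∀ᶠ t in F, f k t = g t := by
  obtain ⟨k, hk⟩ : ∃ k, ∃ᶠ t in F, f k t = g t := by
    by_contra! h
    obtain ⟨t, ht⟩ := (eventually_all.2 h).exists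
    obtain ⟨k, hk⟩ := hmem t
    exact ht k hk
  have hkl (l : ι) : ∀ᶠ t in F, f k t ≤ f l t := by
    have hfr : ∃ᶠ t in F, f k t ≤ f l t := hk.mono fun t ht => ht.le.trans (hle l t)
    have han := ((hf k).sub (hf l)).analyticAt
    by_cases hz : ∀ᶠ t in 𝓝 t₀, f k t - f l t = 0
    · exact (hz.filter_mono hF).mono fun t ht => (sub_eq_zero.1 ht).le
    obtain ⟨m, u, hu, hu0, hfu⟩ := han.exists_eventuallyEq_pow_smul_nonzero_iff.2 hz
    have hfu' := hfu.filter_mono hF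
    -- On `F`, the difference is either eventually negative or eventually positive.
    have hdich : (∀ᶠ t in F, f k t - f l t < 0) ∨ ∀ᶠ t in F, 0 < f k t - f l t := by
      rcases lt_or_gt_of_ne hu0 with hs | hs
      · have hu' := (hu.continuousAt.eventually_lt_const hs).filter_mono hF
        rcases hpow m with hp | hp
        · left
          filter_upwards [hfu', hu', hp] with t h1 h2 h3
          exact h1.trans_lt (mul_neg_of_pos_of_neg h3 h2)
        · right
          filter_upwards [hfu', hu', hp] with t h1 h2 h3
          exact (mul_pos_of_neg_of_neg h3 h2).trans_eq h1.symm
      · have hu' := (hu.continuousAt.eventually_const_lt hs).filter_mono hF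
        rcases hpow m with hp | hp
        · right
          filter_upwards [hfu', hu', hp] with t h1 h2 h3
          exact (mul_pos h3 h2).trans_eq h1.symm
        · left
          filter_upwards [hfu', hu', hp] with t h1 h2 h3
          exact h1.trans_lt (mul_neg_of_neg_of_pos h3 h2)
    rcases hdich with hd | hd
    · exact hd.mono fun t ht => (sub_neg.1 ht).le
    · obtain ⟨t, h1, h2⟩ := (hfr.and_eventually hd).exists
      exact absurd h1 (not_le.2 (sub_pos.1 h2))
  refine ⟨k, ?_, ?_⟩
  · obtain ⟨j, hj⟩ := hmem t₀
    refine le_antisymm ?_ (hle k t₀)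
    rw [← hj]
    exact le_of_tendsto_of_tendsto ((hf k).continuousAt.tendsto.mono_left hF)
      ((hf j).continuousAt.tendsto.mono_left hF) (hkl j)
  · filter_upwards [eventually_all.2 hkl] with t ht
    obtain ⟨j, hj⟩ := hmem t
    exact le_antisymm ((ht j).trans_eq hj) (hle k t)

theorem exists_eventually_eq_right {ι : Type*} [Finite ι] {f : ι → ℝ → ℝ} {g : ℝ → ℝ} {t₀ : ℝ}
    (hf : ∀ k, ContDiffAt ℝ ω (f k) t₀) (hle : ∀ k t, g t ≤ f k t)
    (hmem : ∀ t, ∃ k, f k t = g t) : ∃ k, f k t₀ = g t₀ ∧ ∀ᶠ t in 𝓝[>] t₀, f k t = g t :=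
  exists_eventually_eq_of_isMin nhdsWithin_le_nhds (fun m => Or.inl (by
    filter_upwards [self_mem_nhdsWithin] with t ht using pow_pos (sub_pos.2 ht) m)) hf hle hmem

theorem exists_eventually_eq_left {ι : Type*} [Finite ι] {f : ι → ℝ → ℝ} {g : ℝ → ℝ} {t₀ : ℝ}
    (hf : ∀ k, ContDiffAt ℝ ω (f k) t₀) (hle : ∀ k t, g t ≤ f k t)
    (hmem : ∀ t, ∃ k, f k t = g t) : ∃ k, f k t₀ = g t₀ ∧ ∀ᶠ t in 𝓝[<] t₀, f k t = g t := by
  refine exists_eventually_eq_of_isMin nhdsWithin_le_nhds (fun m => ?_) hf hle hmem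
  rcases Nat.even_or_odd m with hm | hm
  · left
    filter_upwards [self_mem_nhdsWithin] with t ht using hm.pow_pos (sub_neg.2 ht).ne
  · right
    filter_upwards [self_mem_nhdsWithin] with t ht using hm.pow_neg (sub_neg.2 ht)

/-- The minimum `g` of finitely many analytic functions is analytic on a punctured neighborhood of
each point. -/
theorem eventually_contDiffAt_of_isMin {ι : Type*} [Finite ι] {f : ι → ℝ → ℝ} {g : ℝ → ℝ} {t₀ : ℝ}
    (hf : ∀ k t, ContDiffAt ℝ ω (f k) t) (hle : ∀ k t, g t ≤ f k t)
    (hmem : ∀ t, ∃ k, f k t = g t) : ∀ᶠ t in 𝓝[≠] t₀, ContDiffAt ℝ ω g t := by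
  obtain ⟨k, -, hk⟩ := exists_eventually_eq_right (fun k => hf k t₀) hle hmem
  obtain ⟨l, -, hl⟩ := exists_eventually_eq_left (fun k => hf k t₀) hle hmem
  rw [← nhdsLT_sup_nhdsGT, eventually_sup]
  constructor
  · filter_upwards [eventually_eventually_nhdsWithin.2 hl, self_mem_nhdsWithin] with t h1 h2
    rw [isOpen_Iio.nhdsWithin_eq h2] at h1
    exact (hf l t).congr_of_eventuallyEq (h1.mono fun s hs => hs.symm)
  · filter_upwards [eventually_eventually_nhdsWithin.2 hk, self_mem_nhdsWithin] with t h1 h2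
    rw [isOpen_Ioi.nhdsWithin_eq h2] at h1
    exact (hf k t).congr_of_eventuallyEq (h1.mono fun s hs => hs.symm)

/-- At a point where the minimum `g` of finitely many analytic functions is not analytic, it
switches from a function `f l` to a function `f k`. Since `g` is the minimum, `f k - f l` changes
from nonnegative to nonpositive values, hence it vanishes to an odd order. -/
theorem exists_branching_of_isMin {ι : Type*} [Finite ι] {f : ι → ℝ → ℝ} {g : ℝ → ℝ} {t₀ : ℝ}
    (hf : ∀ k, ContDiffAt ℝ ω (f k) t₀) (hle : ∀ k t, g t ≤ f k t)
    (hmem : ∀ t, ∃ k, f k t = g t) (hg : ¬ ContDiffAt ℝ ω g t₀) :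
    ∃ (k l : ι) (n : ℕ) (u : ℝ → ℝ), Even n ∧ ContDiffAt ℝ ω u t₀ ∧ u t₀ ≠ 0 ∧
      f k t₀ = g t₀ ∧ f l t₀ = g t₀ ∧
      (∀ᶠ t in 𝓝[>] t₀, f k t = g t) ∧ (∀ᶠ t in 𝓝[<] t₀, f l t = g t) ∧
      (∀ᶠ t in 𝓝 t₀, f k t = f l t + (t - t₀) ^ (n + 1) * u t) ∧
      ∀ᶠ t in 𝓝 t₀, g t = f l t + max (t - t₀) 0 ^ (n + 1) * u t := by
  obtain ⟨k, hk0, hk⟩ := exists_eventually_eq_right hf hle hmem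
  obtain ⟨l, hl0, hl⟩ := exists_eventually_eq_left hf hle hmem
  have hk' : ∀ᶠ t in 𝓝 t₀, t₀ < t → f k t = g t := eventually_nhdsWithin_iff.1 hk
  have hl' : ∀ᶠ t in 𝓝 t₀, t < t₀ → f l t = g t := eventually_nhdsWithin_iff.1 hl
  have hz : ¬ ∀ᶠ t in 𝓝 t₀, f k t - f l t = 0 := by
    refine fun hz => hg ((hf k).congr_of_eventuallyEq ?_)
    filter_upwards [hz, hk', hl'] with t h1 h2 h3
    rcases lt_trichotomy t t₀ with h | rfl | h
    · rw [← h3 h, ← sub_eq_zero.1 h1]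
    · exact hk0.symm
    · exact (h2 h).symm
  obtain ⟨q, u, hu, hu0, hfu⟩ :=
    ((hf k).sub (hf l)).analyticAt.exists_eventuallyEq_pow_smul_nonzero_iff.2 hz
  simp only [smul_eq_mul] at hfu
  obtain ⟨n, rfl⟩ : ∃ n, q = n + 1 := by
    refine Nat.exists_eq_succ_of_ne_zero ?_
    rintro rfl
    have := hfu.self_of_nhds
    rw [hk0, hl0, sub_self, pow_zero, one_mul] at this
    exact hu0 this.symm
  have heven : Even (n + 1 + 1) := by
    refine (even_and_pos_of_pow_mul_nonneg (u := fun t => -u t) (t₀ := t₀) hu.continuousAt.neg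
      (neg_ne_zero.2 hu0) ?_).1
    filter_upwards [hfu, hk', hl'] with t h1 h2 h3
    have h4 : (t - t₀) ^ (n + 1 + 1) * -u t = (t - t₀) * (f l t - f k t) := by
      rw [pow_succ', mul_assoc, mul_neg, ← h1, neg_sub]
    rw [h4]
    rcases lt_trichotomy t t₀ with h | rfl | h
    · refine mul_nonneg_of_nonpos_of_nonpos (sub_neg.2 h).le (sub_nonpos.2 ?_)
      exact (h3 h).trans_le (hle k t)
    · rw [sub_self, zero_mul]
    · refine mul_nonneg (sub_pos.2 h).le (sub_nonneg.2 ?_)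
      exact (h2 h).trans_le (hle l t)
  refine ⟨k, l, n, u, by simpa [Nat.even_add_one] using heven, hu.contDiffAt, hu0, hk0, hl0,
    hk, hl, hfu.mono fun t ht => by rw [← ht]; ring, ?_⟩
  filter_upwards [hfu, hk', hl'] with t h1 h2 h3
  rcases lt_trichotomy t t₀ with h | rfl | h
  · rw [max_eq_right (sub_neg.2 h).le, zero_pow (by omega), zero_mul, add_zero, h3 h]
  · rw [sub_self, max_self, zero_pow (by omega), zero_mul, add_zero, hl0]
  · rw [max_eq_left (sub_pos.2 h).le, ← h1, add_sub_cancel, h2 h]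

/-! ### Eigenfunctions and the smallest eigenvalue -/

namespace IsAnalyticEigenbasis

variable {A : Matrix (Fin d) (Fin d) ℂ} {ψ : Fin d → ℝ → EuclideanSpace ℂ (Fin d)}

theorem apply_eq (hψ : IsAnalyticEigenbasis A ψ) (k : Fin d) (θ : ℝ) :
    Matrix.toEuclideanLin (rotatedRe A θ) (ψ k θ) = (eigenfunction A ψ k θ : ℂ) • ψ k θ := by
  obtain ⟨μ, hμ⟩ := hψ.eigenvector k θ
  have h1 := hμ.apply_eq_smul
  have hsym := Matrix.isSymmetric_toEuclideanLin_iff.2 (rotatedRe_isHermitian A θ)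
  have hreal : (starRingEnd ℂ) μ = μ :=
    hsym.conj_eigenvalue_eq_self (Module.End.hasEigenvalue_of_hasEigenvector hμ)
  have h2 : eigenfunction A ψ k θ = μ.re := by
    rw [eigenfunction, h1, inner_smul_right, inner_self_eq_norm_sq_to_K,
      (hψ.orthonormal θ).1 k]
    simp
  rw [h1, h2, Complex.conj_eq_iff_re.1 hreal]

theorem contDiffAt_eigenfunction (hψ : IsAnalyticEigenbasis A ψ) (k : Fin d) (θ : ℝ) :
    ContDiffAt ℝ ω (eigenfunction A ψ k) θ := by
  have h1 : ContDiffAt ℝ ω (ψ k) θ := (hψ.analytic k θ).contDiffAt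
  have h2 : ContDiffAt ℝ ω
      (fun θ => Matrix.toEuclideanLin (rotatedRe A θ) (ψ k θ)) θ := by
    refine (contDiffAt_piLp 2).2 fun i => ?_
    simp only [Matrix.toLpLin_apply, Matrix.mulVec, dotProduct]
    exact ContDiffAt.sum fun j _ =>
      (contDiffAt_rotatedRe A i j θ).mul (contDiffAt_euclidean_apply h1 j)
  exact Complex.reCLM.contDiff.contDiffAt.comp θ (h1.inner ℂ h2)

/-- The orthonormal eigenbasis at a fixed angle. -/
noncomputable def basis (hψ : IsAnalyticEigenbasis A ψ) (θ : ℝ) :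
    OrthonormalBasis (Fin d) ℂ (EuclideanSpace ℂ (Fin d)) :=
  OrthonormalBasis.mk (hψ.orthonormal θ)
    ((hψ.orthonormal θ).linearIndependent.span_eq_top_of_card_eq_finrank' (by simp)).ge

theorem basis_apply (hψ : IsAnalyticEigenbasis A ψ) (θ : ℝ) (k : Fin d) :
    hψ.basis θ k = ψ k θ := by
  simp [basis]

theorem inner_apply (hψ : IsAnalyticEigenbasis A ψ) (θ : ℝ) (k : Fin d)
    (x : EuclideanSpace ℂ (Fin d)) :
    inner ℂ (ψ k θ) (Matrix.toEuclideanLin (rotatedRe A θ) x) =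
      (eigenfunction A ψ k θ : ℂ) * inner ℂ (ψ k θ) x := by
  have hsym := Matrix.isSymmetric_toEuclideanLin_iff.2 (rotatedRe_isHermitian A θ)
  rw [← hsym, hψ.apply_eq, inner_smul_left, Complex.conj_ofReal]

theorem mem_spectrum_iff (hψ : IsAnalyticEigenbasis A ψ) (θ r : ℝ) :
    r ∈ spectrum ℝ (rotatedRe A θ) ↔ ∃ k, eigenfunction A ψ k θ = r := by
  rw [← spectrum.algebraMap_mem_iff ℂ, ← Matrix.spectrum_toLpLin 2,
    ← Module.End.hasEigenvalue_iff_mem_spectrum]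
  constructor
  · intro h
    obtain ⟨x, hx⟩ := h.exists_hasEigenvector
    obtain ⟨k, hk⟩ : ∃ k, inner ℂ (ψ k θ) x ≠ 0 := by
      by_contra! h0
      refine hx.2 ?_
      rw [← (hψ.basis θ).sum_repr' x]
      exact Finset.sum_eq_zero fun k _ => by rw [basis_apply, h0, zero_smul]
    refine ⟨k, ?_⟩
    have h1 := hψ.inner_apply θ k x
    rw [hx.apply_eq_smul, inner_smul_right] at h1
    exact (Complex.ofReal_injective (mul_right_cancel₀ hk h1)).symm
  · rintro ⟨k, rfl⟩
    exact Module.End.hasEigenvalue_of_hasEigenvector (x := ψ k θ)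
      (Module.End.hasEigenvector_iff.2 ⟨Module.End.mem_eigenspace_iff.2 (hψ.apply_eq k θ),
        (hψ.orthonormal θ).ne_zero k⟩)

theorem minEigenvalue_le [NeZero d] (hψ : IsAnalyticEigenbasis A ψ) (k : Fin d) (θ : ℝ) :
    minEigenvalue A θ ≤ eigenfunction A ψ k θ :=
  (minEigenvalue_isLeast A θ).2 ((hψ.mem_spectrum_iff θ _).2 ⟨k, rfl⟩)

theorem exists_eq_minEigenvalue [NeZero d] (hψ : IsAnalyticEigenbasis A ψ) (θ : ℝ) :
    ∃ k, eigenfunction A ψ k θ = minEigenvalue A θ :=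
  (hψ.mem_spectrum_iff θ _).1 (minEigenvalue_isLeast A θ).1

/-- The smallest eigenvalue is the minimum of the Rayleigh quotient. -/
theorem minEigenvalue_le_inner [NeZero d] (hψ : IsAnalyticEigenbasis A ψ) (θ : ℝ)
    {x : EuclideanSpace ℂ (Fin d)} (hx : ‖x‖ = 1) :
    minEigenvalue A θ ≤ (inner ℂ x (Matrix.toEuclideanLin (rotatedRe A θ) x)).re := by
  have h1 : (inner ℂ x (Matrix.toEuclideanLin (rotatedRe A θ) x)).re =
      ∑ k, eigenfunction A ψ k θ * ‖inner ℂ (ψ k θ) x‖ ^ 2 := by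
    rw [← (hψ.basis θ).sum_inner_mul_inner, Complex.re_sum]
    refine Finset.sum_congr rfl fun k _ => ?_
    rw [basis_apply, hψ.inner_apply, ← inner_conj_symm x (ψ k θ), mul_left_comm,
      RCLike.conj_mul, Complex.re_ofReal_mul]
    norm_cast
  have h2 : ∑ k, ‖inner ℂ (ψ k θ) x‖ ^ 2 = 1 := by
    have := (hψ.basis θ).sum_sq_norm_inner_right x
    simpa [basis_apply, hx] using this
  rw [h1, ← mul_one (minEigenvalue A θ), ← h2, Finset.mul_sum]
  exact Finset.sum_le_sum fun k _ =>
    mul_le_mul_of_nonneg_right (hψ.minEigenvalue_le k θ) (sq_nonneg _)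

end IsAnalyticEigenbasis

/-! ### The numerical range and its exposed faces -/

/-- The Euclidean scalar product of `z` with the unit vector `exp (iθ)`. -/
noncomputable def proj (z : ℂ) (θ : ℝ) : ℝ := (Complex.exp (-(Complex.I * θ)) * z).re

theorem inner_circleExp (z : ℂ) (θ : ℝ) : inner ℝ z (Circle.exp θ : ℂ) = proj z θ := by
  rw [real_inner_comm, Complex.inner, proj, Circle.coe_exp, ← Complex.exp_conj]
  simp [mul_comm]

theorem hasDerivAt_proj (z : ℂ) (θ : ℝ) :
    HasDerivAt (proj z) (Complex.exp (-(Complex.I * θ)) * z).im θ := by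
  have h1 : HasDerivAt (fun θ : ℝ => Complex.exp (-(Complex.I * θ)) * z)
      (Complex.exp (-(Complex.I * θ)) * (-(Complex.I * 1)) * z) θ :=
    ((((hasDerivAt_id (θ : ℂ)).const_mul Complex.I).neg.cexp).mul_const z).comp_ofReal
  have h2 := Complex.reCLM.hasFDerivAt.comp_hasDerivAt θ h1
  have h3 : Complex.reCLM (Complex.exp (-(Complex.I * θ)) * (-(Complex.I * 1)) * z) =
      (Complex.exp (-(Complex.I * θ)) * z).im := by
    have : Complex.exp (-(Complex.I * θ)) * (-(Complex.I * 1)) * z =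
      -(Complex.I * (Complex.exp (-(Complex.I * θ)) * z)) := by ring
    rw [this, Complex.reCLM_apply, Complex.neg_re, Complex.I_mul_re, neg_neg]
  rw [h3] at h2
  exact h2

theorem inner_rotatedRe (A : Matrix (Fin d) (Fin d) ℂ) (θ : ℝ) (x : EuclideanSpace ℂ (Fin d)) :
    (inner ℂ x (Matrix.toEuclideanLin (rotatedRe A θ) x)).re =
      proj (inner ℂ x (Matrix.toEuclideanLin A x)) θ := by
  set c := Complex.exp (-(Complex.I * (θ : ℂ))) with hc
  have h1 : rotatedRe A θ = (2⁻¹ : ℂ) • (c • A + (c • A).conjTranspose) := by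
    rw [rotatedRe, realPart_apply_coe, Matrix.star_eq_conjTranspose]
    ext i j
    simp [hc]
    ring
  have h2 : inner ℂ x (Matrix.toEuclideanLin (c • A) x) =
      c * inner ℂ x (Matrix.toEuclideanLin A x) := by
    rw [map_smul, LinearMap.smul_apply, inner_smul_right]
  rw [h1, map_smul, map_add, LinearMap.smul_apply, LinearMap.add_apply, inner_smul_right,
    inner_add_right, Matrix.toEuclideanLin_conjTranspose_eq_adjoint, LinearMap.adjoint_inner_right,
    ← inner_conj_symm (Matrix.toEuclideanLin (c • A) x) x, h2, Complex.add_conj, proj, ← hc]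
  push_cast
  rw [inv_mul_cancel_left₀ two_ne_zero, Complex.ofReal_re]

theorem minEigenvalue_le_proj [NeZero d] (A : Matrix (Fin d) (Fin d) ℂ) {z : ℂ}
    (hz : z ∈ numericalRange A) (θ : ℝ) : minEigenvalue A θ ≤ proj z θ := by
  obtain ⟨ψ, hψ⟩ := exists_isAnalyticEigenbasis A
  obtain ⟨x, hx, rfl⟩ := hz
  rw [← inner_rotatedRe]
  exact hψ.minEigenvalue_le_inner θ hx

namespace IsAnalyticEigenbasis

variable {A : Matrix (Fin d) (Fin d) ℂ} {ψ : Fin d → ℝ → EuclideanSpace ℂ (Fin d)}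

theorem inner_mem_numericalRange (hψ : IsAnalyticEigenbasis A ψ) (k : Fin d) (θ : ℝ) :
    inner ℂ (ψ k θ) (Matrix.toEuclideanLin A (ψ k θ)) ∈ numericalRange A :=
  ⟨_, (hψ.orthonormal θ).1 k, rfl⟩

theorem proj_inner (A : Matrix (Fin d) (Fin d) ℂ) (ψ : Fin d → ℝ → EuclideanSpace ℂ (Fin d))
    (k : Fin d) (θ : ℝ) :
    proj (inner ℂ (ψ k θ) (Matrix.toEuclideanLin A (ψ k θ))) θ = eigenfunction A ψ k θ :=
  (inner_rotatedRe A θ (ψ k θ)).symm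

theorem continuous_inner (hψ : IsAnalyticEigenbasis A ψ) (k : Fin d) :
    Continuous fun θ => inner ℂ (ψ k θ) (Matrix.toEuclideanLin A (ψ k θ)) := by
  have h1 : Continuous (ψ k) :=
    continuous_iff_continuousAt.2 fun θ => (hψ.analytic k θ).continuousAt
  exact h1.inner ((LinearMap.continuous_of_finiteDimensional _).comp h1)

end IsAnalyticEigenbasis

theorem mem_exposedFace_iff [NeZero d] (A : Matrix (Fin d) (Fin d) ℂ) (θ : ℝ) (z : ℂ) :
    z ∈ exposedFace (numericalRange A) (Circle.exp θ) ↔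
      z ∈ numericalRange A ∧ proj z θ = minEigenvalue A θ := by
  simp only [exposedFace, Set.mem_ofPred_eq, inner_circleExp]
  refine and_congr_right fun hz => ⟨fun h => ?_, fun h y hy => ?_⟩
  · obtain ⟨ψ, hψ⟩ := exists_isAnalyticEigenbasis A
    obtain ⟨k, hk⟩ := hψ.exists_eq_minEigenvalue θ
    refine le_antisymm ?_ (minEigenvalue_le_proj A hz θ)
    rw [← hk, ← IsAnalyticEigenbasis.proj_inner]
    exact h _ (hψ.inner_mem_numericalRange k θ)
  · rw [h]
    exact minEigenvalue_le_proj A hy θ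

/-- The point `exp (iθ) * (λ(θ) + i λ'(θ))`, where `λ` is the smallest eigenvalue. It is the value
of the reverse Gauss map if `λ` is differentiable at `θ`. -/
noncomputable def supportPoint (A : Matrix (Fin d) (Fin d) ℂ) (θ : ℝ) : ℂ :=
  Complex.exp (Complex.I * θ) * (minEigenvalue A θ + Complex.I * deriv (minEigenvalue A) θ)

theorem eq_exp_mul (z : ℂ) (θ : ℝ) : z = Complex.exp (Complex.I * θ) *
    (proj z θ + Complex.I * (Complex.exp (-(Complex.I * θ)) * z).im) := by
  rw [mul_comm Complex.I ((Complex.exp (-(Complex.I * θ)) * z).im : ℂ), proj, Complex.re_add_im,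
    ← mul_assoc, ← Complex.exp_add]
  simp

/-- For `z` in the exposed face at `θ`, the function `φ ↦ proj z φ - λ(φ)` has a minimum at `θ`. -/
theorem eq_supportPoint [NeZero d] {A : Matrix (Fin d) (Fin d) ℂ} {θ : ℝ} {z : ℂ}
    (hd : DifferentiableAt ℝ (minEigenvalue A) θ)
    (hz : z ∈ exposedFace (numericalRange A) (Circle.exp θ)) : z = supportPoint A θ := by
  obtain ⟨hzW, hzθ⟩ := (mem_exposedFace_iff A θ z).1 hz
  have hmin : IsLocalMin (fun φ => proj z φ - minEigenvalue A φ) θ := by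
    refine Eventually.of_forall fun φ => ?_
    change proj z θ - minEigenvalue A θ ≤ proj z φ - minEigenvalue A φ
    rw [hzθ, sub_self]
    exact sub_nonneg.2 (minEigenvalue_le_proj A hzW φ)
  have h1 := hmin.hasDerivAt_eq_zero ((hasDerivAt_proj z θ).sub hd.hasDerivAt)
  rw [supportPoint, ← hzθ, ← sub_eq_zero.1 h1]
  exact eq_exp_mul z θ

theorem exposedFace_eq_singleton [NeZero d] {A : Matrix (Fin d) (Fin d) ℂ} {θ : ℝ}
    (hd : DifferentiableAt ℝ (minEigenvalue A) θ) :
    exposedFace (numericalRange A) (Circle.exp θ) = {supportPoint A θ} := by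
  refine Set.eq_singleton_iff_nonempty_unique_mem.2 ⟨?_, fun z hz => eq_supportPoint hd hz⟩
  obtain ⟨ψ, hψ⟩ := exists_isAnalyticEigenbasis A
  obtain ⟨k, hk⟩ := hψ.exists_eq_minEigenvalue θ
  exact ⟨_, (mem_exposedFace_iff A θ _).2 ⟨hψ.inner_mem_numericalRange k θ,
    (IsAnalyticEigenbasis.proj_inner A ψ k θ).trans hk⟩⟩

theorem mem_regnAngles_of_differentiableAt [NeZero d] {A : Matrix (Fin d) (Fin d) ℂ} {θ : ℝ}
    (hd : DifferentiableAt ℝ (minEigenvalue A) θ) : θ ∈ regnAngles (numericalRange A) :=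
  ⟨_, exposedFace_eq_singleton hd⟩

theorem reverseGauss_eq_supportPoint [NeZero d] {A : Matrix (Fin d) (Fin d) ℂ} {θ : ℝ}
    (hd : DifferentiableAt ℝ (minEigenvalue A) θ) :
    reverseGauss (numericalRange A) (Circle.exp θ) = supportPoint A θ :=
  Set.singleton_injective ((exposedFace_eq_reverseGauss
    (mem_regnAngles_of_differentiableAt hd)).symm.trans (exposedFace_eq_singleton hd))

/-! ### Regularity on the set of regular angles -/

theorem contDiffAt_deriv_iff {g : ℝ → ℝ} {t₀ : ℝ} {m : ℕ}
    (hg : ∀ᶠ t in 𝓝 t₀, DifferentiableAt ℝ g t) :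
    ContDiffAt ℝ m (deriv g) t₀ ↔ ContDiffAt ℝ ((m + 1 : ℕ) : ℕ∞ω) g t₀ := by
  constructor
  · intro h
    rw [Nat.cast_add, Nat.cast_one, contDiffAt_succ_iff_hasFDerivAt]
    refine ⟨fun t => ContinuousLinearMap.toSpanSingleton ℝ (deriv g t),
      ⟨_, hg, fun t ht => DifferentiableAt.hasDerivAt ht |>.hasFDerivAt⟩, ?_⟩
    exact ContinuousLinearMap.toSpanSingletonCLE.contDiff.contDiffAt.comp t₀ h
  · intro h
    exact (h.fderiv_right (m := (m : ℕ∞ω)) (by norm_cast)).clm_apply contDiffAt_const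

namespace IsAnalyticEigenbasis

variable {A : Matrix (Fin d) (Fin d) ℂ} {ψ : Fin d → ℝ → EuclideanSpace ℂ (Fin d)}

/-- If `λ` agrees with the eigenfunction `λ_k` on one side of `θ`, then the point of the numerical
range given by `ψ k θ` is the one-sided limit of the support points. -/
theorem inner_eq_of_eventually_eq [NeZero d] (hψ : IsAnalyticEigenbasis A ψ) {k : Fin d} {θ : ℝ}
    {F : Filter ℝ} [F.NeBot] (hF : F ≤ 𝓝 θ)
    (h : ∀ᶠ t in F, ∀ᶠ s in 𝓝 t, eigenfunction A ψ k s = minEigenvalue A s) :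
    inner ℂ (ψ k θ) (Matrix.toEuclideanLin A (ψ k θ)) = Complex.exp (Complex.I * θ) *
      (eigenfunction A ψ k θ + Complex.I * deriv (eigenfunction A ψ k) θ) := by
  have hdc : ContinuousAt (deriv (eigenfunction A ψ k)) θ :=
    (hψ.contDiffAt_eigenfunction k θ).analyticAt.deriv.continuousAt
  have h1 : ContinuousAt (fun t : ℝ => Complex.exp (Complex.I * t) *
      (eigenfunction A ψ k t + Complex.I * deriv (eigenfunction A ψ k) t)) θ := by
    have h2 := (hψ.contDiffAt_eigenfunction k θ).continuousAt
    refine ContinuousAt.mul (by fun_prop) (ContinuousAt.add ?_ (continuousAt_const.mul ?_))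
    · exact Complex.continuous_ofReal.continuousAt.comp h2
    · exact Complex.continuous_ofReal.continuousAt.comp hdc
  refine tendsto_nhds_unique_of_eventuallyEq
    ((hψ.continuous_inner k).continuousAt.tendsto.mono_left hF) (h1.tendsto.mono_left hF) ?_
  filter_upwards [h] with t ht
  have hd : DifferentiableAt ℝ (minEigenvalue A) t :=
    ((hψ.contDiffAt_eigenfunction k t).differentiableAt (by simp)).congr_of_eventuallyEq
      (ht.mono fun s hs => hs.symm)
  have h3 := eq_supportPoint hd ((mem_exposedFace_iff A t _).2
    ⟨hψ.inner_mem_numericalRange k t, (proj_inner A ψ k t).trans ht.self_of_nhds⟩)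
  rw [h3, supportPoint, ← ht.self_of_nhds, EventuallyEq.deriv_eq ht]

theorem exists_branching [NeZero d] (hψ : IsAnalyticEigenbasis A ψ) {θ : ℝ}
    (hθ : ¬ ContDiffAt ℝ ω (minEigenvalue A) θ) :
    ∃ (k l : Fin d) (n : ℕ) (u : ℝ → ℝ), Even n ∧ ContDiffAt ℝ ω u θ ∧ u θ ≠ 0 ∧
      eigenfunction A ψ k θ = minEigenvalue A θ ∧ eigenfunction A ψ l θ = minEigenvalue A θ ∧
      (∀ᶠ t in 𝓝[>] θ, eigenfunction A ψ k t = minEigenvalue A t) ∧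
      (∀ᶠ t in 𝓝[<] θ, eigenfunction A ψ l t = minEigenvalue A t) ∧
      (∀ᶠ t in 𝓝 θ, eigenfunction A ψ k t =
        eigenfunction A ψ l t + (t - θ) ^ (n + 1) * u t) ∧
      ∀ᶠ t in 𝓝 θ, minEigenvalue A t =
        eigenfunction A ψ l t + max (t - θ) 0 ^ (n + 1) * u t :=
  exists_branching_of_isMin (fun k => hψ.contDiffAt_eigenfunction k θ) hψ.minEigenvalue_le
    hψ.exists_eq_minEigenvalue hθ

/-- The smallest eigenvalue is analytic at an angle if and only if it agrees locally with one of the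
eigenfunctions. -/
theorem analyticAt_minEigenvalue_iff [NeZero d] (hψ : IsAnalyticEigenbasis A ψ) (θ : ℝ) :
    AnalyticAt ℝ (minEigenvalue A) θ ↔
      ∃ k, ∀ᶠ φ in 𝓝 θ, eigenfunction A ψ k φ = minEigenvalue A φ := by
  constructor
  · intro h
    obtain ⟨k, -, hk⟩ := exists_eventually_eq_right
      (fun k => hψ.contDiffAt_eigenfunction k θ) hψ.minEigenvalue_le hψ.exists_eq_minEigenvalue
    exact ⟨k, ((hψ.contDiffAt_eigenfunction k θ).analyticAt.frequently_eq_iff_eventually_eq h).1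
      (hk.frequently.filter_mono (nhdsGT_le_nhdsNE θ))⟩
  · rintro ⟨k, hk⟩
    exact (hψ.contDiffAt_eigenfunction k θ).analyticAt.congr hk

end IsAnalyticEigenbasis

theorem eventually_analyticAt_minEigenvalue [NeZero d] (A : Matrix (Fin d) (Fin d) ℂ) (θ : ℝ) :
    ∀ᶠ φ in 𝓝[≠] θ, AnalyticAt ℝ (minEigenvalue A) φ := by
  obtain ⟨ψ, hψ⟩ := exists_isAnalyticEigenbasis A
  exact (eventually_contDiffAt_of_isMin hψ.contDiffAt_eigenfunction hψ.minEigenvalue_le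
    hψ.exists_eq_minEigenvalue).mono fun φ hφ => hφ.analyticAt

theorem finite_not_analyticAt_minEigenvalue [NeZero d] (A : Matrix (Fin d) (Fin d) ℂ) (a b : ℝ) :
    {θ : ℝ | θ ∈ Set.Ico a b ∧ ¬ AnalyticAt ℝ (minEigenvalue A) θ}.Finite := by
  by_contra hinf
  obtain ⟨θ, -, hθ⟩ := Set.Infinite.exists_accPt_of_subset_isCompact (K := Set.Icc a b) hinf
    isCompact_Icc fun θ hθ => Set.Ico_subset_Icc_self hθ.1
  rw [accPt_iff_frequently_nhdsNE] at hθ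
  obtain ⟨φ, h1, h2⟩ := (hθ.and_eventually (eventually_analyticAt_minEigenvalue A θ)).exists
  exact h1.2 h2

theorem exists_hasMaximalOrder [NeZero d] {A : Matrix (Fin d) (Fin d) ℂ} {θ : ℝ}
    (hθ : ¬ AnalyticAt ℝ (minEigenvalue A) θ) :
    ∃ m, HasMaximalOrder (minEigenvalue A) θ m ∧ Even m := by
  obtain ⟨ψ, hψ⟩ := exists_isAnalyticEigenbasis A
  obtain ⟨k, l, n, u, hn, hu, hu0, -, -, -, -, -, hmin⟩ :=
    hψ.exists_branching fun h => hθ h.analyticAt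
  exact ⟨n, hasMaximalOrder_of_eventually_eq (hψ.contDiffAt_eigenfunction l θ) hu hu0 hmin, hn⟩

/-- At a regular angle, the derivatives from the left and from the right of the smallest eigenvalue
coincide, because both are determined by the unique point of the exposed face. Hence the maximal
order is positive where the smallest eigenvalue is not analytic. -/
theorem exists_hasMaximalOrder_of_mem_regnAngles [NeZero d] {A : Matrix (Fin d) (Fin d) ℂ} {θ : ℝ}
    (hreg : θ ∈ regnAngles (numericalRange A)) (hθ : ¬ AnalyticAt ℝ (minEigenvalue A) θ) :
    ∃ m, HasMaximalOrder (minEigenvalue A) θ (m + 1) ∧ 2 ≤ m + 1 := by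
  obtain ⟨ψ, hψ⟩ := exists_isAnalyticEigenbasis A
  obtain ⟨k, l, n, u, hn, hu, hu0, hk0, hl0, hk, hl, hkl, hmin⟩ :=
    hψ.exists_branching fun h => hθ h.analyticAt
  have hmax := hasMaximalOrder_of_eventually_eq (hψ.contDiffAt_eigenfunction l θ) hu hu0 hmin
  have hn0 : n ≠ 0 := by
    rintro rfl
    obtain ⟨z, hz⟩ := hreg
    have hface {j : Fin d} (hj : eigenfunction A ψ j θ = minEigenvalue A θ) :
        inner ℂ (ψ j θ) (Matrix.toEuclideanLin A (ψ j θ)) = z := by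
      rw [← Set.mem_singleton_iff, ← hz, mem_exposedFace_iff]
      exact ⟨hψ.inner_mem_numericalRange j θ,
        (IsAnalyticEigenbasis.proj_inner A ψ j θ).trans hj⟩
    have hk' : ∀ᶠ t in 𝓝[>] θ, ∀ᶠ s in 𝓝 t,
        eigenfunction A ψ k s = minEigenvalue A s := by
      filter_upwards [eventually_eventually_nhdsWithin.2 hk, self_mem_nhdsWithin] with t h1 h2
      rwa [isOpen_Ioi.nhdsWithin_eq h2] at h1
    have hl' : ∀ᶠ t in 𝓝[<] θ, ∀ᶠ s in 𝓝 t,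
        eigenfunction A ψ l s = minEigenvalue A s := by
      filter_upwards [eventually_eventually_nhdsWithin.2 hl, self_mem_nhdsWithin] with t h1 h2
      rwa [isOpen_Iio.nhdsWithin_eq h2] at h1
    have h1 := hψ.inner_eq_of_eventually_eq nhdsWithin_le_nhds hk'
    have h2 := hψ.inner_eq_of_eventually_eq nhdsWithin_le_nhds hl'
    rw [hface hk0] at h1
    rw [hface hl0, h1, hk0, hl0] at h2
    have h3 := Complex.ofReal_injective (mul_left_cancel₀ Complex.I_ne_zero
      (add_left_cancel (mul_left_cancel₀ (Complex.exp_ne_zero _) h2)))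
    have h4 : HasDerivAt (eigenfunction A ψ k) (deriv (eigenfunction A ψ l) θ + u θ) θ := by
      have h5 : HasDerivAt (fun t => (t - θ) ^ (0 + 1) * u t) (u θ) θ := by
        have := ((hasDerivAt_id' θ).sub_const θ).fun_mul
          (hu.differentiableAt (by simp)).hasDerivAt
        simpa using this
      exact (((hψ.contDiffAt_eigenfunction l θ).differentiableAt (by simp)).hasDerivAt.add
        h5).congr_of_eventuallyEq hkl
    exact hu0 (by linarith [h4.deriv])
  obtain ⟨m, rfl⟩ := Nat.exists_eq_succ_of_ne_zero hn0
  refine ⟨m, hmax, ?_⟩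
  obtain ⟨j, hj⟩ := hn
  omega

theorem contDiffAt_two_of_mem_regnAngles [NeZero d] {A : Matrix (Fin d) (Fin d) ℂ} {θ : ℝ}
    (hreg : θ ∈ regnAngles (numericalRange A)) : ContDiffAt ℝ 2 (minEigenvalue A) θ := by
  by_cases hθ : AnalyticAt ℝ (minEigenvalue A) θ
  · exact hθ.contDiffAt.of_le le_top
  · obtain ⟨m, hm, hm2⟩ := exists_hasMaximalOrder_of_mem_regnAngles hreg hθ
    exact hm.1.of_le (by exact_mod_cast hm2)

theorem eventually_differentiableAt_of_mem_regnAngles [NeZero d] {A : Matrix (Fin d) (Fin d) ℂ}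
    {θ : ℝ} (hreg : θ ∈ regnAngles (numericalRange A)) :
    ∀ᶠ φ in 𝓝 θ, DifferentiableAt ℝ (minEigenvalue A) φ :=
  ((contDiffAt_two_of_mem_regnAngles hreg).eventually (by simp)).mono fun _ h =>
    h.differentiableAt (by simp)

theorem isOpen_regnAngles_numericalRange [NeZero d] (A : Matrix (Fin d) (Fin d) ℂ) :
    IsOpen (regnAngles (numericalRange A)) :=
  isOpen_iff_mem_nhds.2 fun _ hθ => (eventually_differentiableAt_of_mem_regnAngles hθ).mono
    fun _ hφ => mem_regnAngles_of_differentiableAt hφ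

theorem contDiffAt_exp_I_mul (c : ℂ) (θ : ℝ) {n : ℕ∞ω} :
    ContDiffAt ℝ n (fun θ : ℝ => Complex.exp (c * θ)) θ :=
  (contDiffAt_const.mul Complex.ofRealCLM.contDiff.contDiffAt).cexp

/-- The point `exp (iθ) * (λ(θ) + i λ'(θ))` depends on `θ` in a `C^m` way where `λ` is
`C^(m + 1)`. -/
theorem contDiffAt_supportPoint_iff [NeZero d] {A : Matrix (Fin d) (Fin d) ℂ} {θ : ℝ} {m : ℕ}
    (hreg : θ ∈ regnAngles (numericalRange A)) :
    ContDiffAt ℝ m (supportPoint A) θ ↔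
      ContDiffAt ℝ ((m + 1 : ℕ) : ℕ∞ω) (minEigenvalue A) θ := by
  rw [← contDiffAt_deriv_iff (eventually_differentiableAt_of_mem_regnAngles hreg)]
  constructor
  · intro h
    have h1 : deriv (minEigenvalue A) = fun φ : ℝ =>
        Complex.imCLM (Complex.exp (-Complex.I * φ) * supportPoint A φ) := by
      funext φ
      rw [supportPoint, ← mul_assoc, ← Complex.exp_add]
      simp
    rw [h1]
    exact Complex.imCLM.contDiff.contDiffAt.comp θ ((contDiffAt_exp_I_mul _ θ).mul h)
  · intro h
    have h1 : ContDiffAt ℝ m (minEigenvalue A) θ :=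
      ((contDiffAt_deriv_iff (eventually_differentiableAt_of_mem_regnAngles hreg)).1 h).of_le
        (by exact_mod_cast Nat.le_succ m)
    exact (contDiffAt_exp_I_mul _ θ).mul ((Complex.ofRealCLM.contDiff.contDiffAt.comp θ h1).add
      (contDiffAt_const.mul (Complex.ofRealCLM.contDiff.contDiffAt.comp θ h)))

theorem analyticAt_supportPoint_iff [NeZero d] {A : Matrix (Fin d) (Fin d) ℂ} {θ : ℝ}
    (hreg : θ ∈ regnAngles (numericalRange A)) :
    ContDiffAt ℝ ω (supportPoint A) θ ↔ AnalyticAt ℝ (minEigenvalue A) θ := by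
  constructor
  · intro h
    by_contra hθ
    obtain ⟨m, hm, -⟩ := exists_hasMaximalOrder hθ
    exact hm.2 ((contDiffAt_supportPoint_iff hreg).1 (h.of_le le_top))
  · intro h
    exact (contDiffAt_exp_I_mul _ θ).mul
      ((Complex.ofRealCLM.contDiff.contDiffAt.comp θ h.contDiffAt).add
      (contDiffAt_const.mul (Complex.ofRealCLM.contDiff.contDiffAt.comp θ h.deriv.contDiffAt)))

/-! ### Maps on the unit circle -/

/-- The exponential map has the local inverse `u ↦ θ + arg (u * exp (-iθ))` at `exp (iθ)`. -/
theorem contMDiffAt_circle_iff {f : Circle → ℂ} {θ : ℝ} {n : ℕ∞ω} :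
    ContMDiffAt (𝓡 1) 𝓘(ℝ, ℂ) n f (Circle.exp θ) ↔
      ContDiffAt ℝ n (fun φ => f (Circle.exp φ)) θ := by
  constructor
  · intro h
    exact (h.comp θ contMDiff_circleExp.contMDiffAt).contDiffAt
  · intro h
    let g : Circle → ℝ := fun u =>
      θ + (Complex.log ((u : ℂ) * ((Circle.exp θ)⁻¹ : Circle))).im
    have hg0 : g (Circle.exp θ) = θ := by
      simp only [g, ← Circle.coe_mul, mul_inv_cancel]
      simp
    have hfg : f = (fun φ => f (Circle.exp φ)) ∘ g := by
      funext u
      simp only [g, Function.comp_apply, ← Circle.coe_mul, Complex.log_im, Circle.exp_add,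
        Circle.exp_arg]
      rw [mul_comm u, mul_inv_cancel_left]
    have hg : ContMDiffAt (𝓡 1) 𝓘(ℝ, ℝ) n g (Circle.exp θ) := by
      have h1 : ContDiffAt ℝ n (fun z : ℂ =>
          θ + (Complex.log (z * ((Circle.exp θ)⁻¹ : Circle))).im) (Circle.exp θ : ℂ) := by
        have h2 : (Circle.exp θ : ℂ) * ((Circle.exp θ)⁻¹ : Circle) ∈ Complex.slitPlane := by
          rw [← Circle.coe_mul, mul_inv_cancel, Circle.coe_one]
          exact Complex.one_mem_slitPlane
        have h3 : ContDiffAt ℝ n (fun z : ℂ => z * ((Circle.exp θ)⁻¹ : Circle)) (Circle.exp θ) :=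
          contDiffAt_id.mul contDiffAt_const
        have hlog : ContDiffAt ℝ n Complex.log ((Circle.exp θ : ℂ) * ((Circle.exp θ)⁻¹ : Circle)) :=
          (Complex.contDiffAt_log h2).restrict_scalars ℝ
        have h4 : ContDiffAt ℝ n (fun z : ℂ => Complex.log (z * ((Circle.exp θ)⁻¹ : Circle)))
            (Circle.exp θ) :=
          ContDiffAt.comp (g := Complex.log) (Circle.exp θ : ℂ) hlog h3
        exact contDiffAt_const.add
          (Complex.imCLM.contDiff.contDiffAt.comp (Circle.exp θ : ℂ) h4)
      have : Fact (Module.finrank ℝ ℂ = 1 + 1) := finrank_real_complex_fact'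
      have h4 : ContMDiff (𝓡 1) 𝓘(ℝ, ℂ) n (fun u : Circle => (u : ℂ)) := contMDiff_coe_sphere
      exact h1.contMDiffAt.comp _ h4.contMDiffAt
    rw [hfg]
    refine ContMDiffAt.comp _ ?_ hg
    rw [hg0]
    exact h.contMDiffAt

theorem contMDiffAt_reverseGauss_iff [NeZero d] {A : Matrix (Fin d) (Fin d) ℂ} {θ : ℝ} {n : ℕ∞ω}
    (hreg : θ ∈ regnAngles (numericalRange A)) :
    ContMDiffAt (𝓡 1) 𝓘(ℝ, ℂ) n (reverseGauss (numericalRange A)) (Circle.exp θ) ↔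
      ContDiffAt ℝ n (supportPoint A) θ := by
  rw [contMDiffAt_circle_iff]
  have h : (fun φ => reverseGauss (numericalRange A) (Circle.exp φ)) =ᶠ[𝓝 θ] supportPoint A :=
    (eventually_differentiableAt_of_mem_regnAngles hreg).mono fun φ hφ =>
      reverseGauss_eq_supportPoint hφ
  exact ⟨fun h' => h'.congr_of_eventuallyEq h.symm, fun h' => h'.congr_of_eventuallyEq h⟩

end NumRange

theorem mainTheorem3 (d : ℕ) [NeZero d] (A : Matrix (Fin d) (Fin d) ℂ) :
    -- the smallest eigenvalue restricts to a `C²` map on the open set of regular angles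
    (IsOpen (NumRange.regnAngles (NumRange.numericalRange A)) ∧
      ContDiffOn ℝ 2 (NumRange.minEigenvalue A)
        (NumRange.regnAngles (NumRange.numericalRange A))) ∧
    -- analytic curves of orthonormal eigenbases exist, and, for each of them, the smallest
    -- eigenvalue is analytic at an angle iff it agrees locally with one of the eigenfunctions
    (∃ ψ : Fin d → ℝ → EuclideanSpace ℂ (Fin d), NumRange.IsAnalyticEigenbasis A ψ) ∧
    (∀ ψ : Fin d → ℝ → EuclideanSpace ℂ (Fin d), NumRange.IsAnalyticEigenbasis A ψ →
      ∀ θ : ℝ, AnalyticAt ℝ (NumRange.minEigenvalue A) θ ↔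
        ∃ k : Fin d, ∀ᶠ φ in nhds θ,
          NumRange.eigenfunction A ψ k φ = NumRange.minEigenvalue A φ) ∧
    -- there are at most finitely many non-analytic points in `[0, 2π)`
    {θ : ℝ | θ ∈ Set.Ico 0 (2 * Real.pi) ∧
      ¬ AnalyticAt ℝ (NumRange.minEigenvalue A) θ}.Finite ∧
    -- at the non-analytic points the maximal order exists and is even
    (∀ θ : ℝ, ¬ AnalyticAt ℝ (NumRange.minEigenvalue A) θ →
      ∃ m : ℕ, NumRange.HasMaximalOrder (NumRange.minEigenvalue A) θ m ∧ Even m) ∧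
    -- the reverse Gauss map is analytic exactly where the smallest eigenvalue is
    (∀ θ ∈ NumRange.regnAngles (NumRange.numericalRange A),
      (NumRange.CircleAnalyticAt (NumRange.reverseGauss (NumRange.numericalRange A))
          (Circle.exp θ) ↔
        AnalyticAt ℝ (NumRange.minEigenvalue A) θ)) ∧
    -- otherwise its maximal order is that of the smallest eigenvalue minus one
    (∀ θ ∈ NumRange.regnAngles (NumRange.numericalRange A),
      ¬ AnalyticAt ℝ (NumRange.minEigenvalue A) θ →
        ∃ m : ℕ, NumRange.HasMaximalOrder (NumRange.minEigenvalue A) θ (m + 1) ∧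
          NumRange.CircleHasMaximalOrder
            (NumRange.reverseGauss (NumRange.numericalRange A)) (Circle.exp θ) m) := by
  refine ⟨⟨NumRange.isOpen_regnAngles_numericalRange A, fun θ hθ =>
      (NumRange.contDiffAt_two_of_mem_regnAngles hθ).contDiffWithinAt⟩,
    NumRange.exists_isAnalyticEigenbasis A, fun ψ hψ => hψ.analyticAt_minEigenvalue_iff,
    NumRange.finite_not_analyticAt_minEigenvalue A 0 (2 * Real.pi),
    fun θ hθ => NumRange.exists_hasMaximalOrder hθ, fun θ hreg => ?_, fun θ hreg hθ => ?_⟩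
  · exact (NumRange.contMDiffAt_reverseGauss_iff hreg).trans
      (NumRange.analyticAt_supportPoint_iff hreg)
  · obtain ⟨m, hm, -⟩ := NumRange.exists_hasMaximalOrder_of_mem_regnAngles hreg hθ
    refine ⟨m, hm, ?_, fun h => ?_⟩
    · exact (NumRange.contMDiffAt_reverseGauss_iff hreg).2
        ((NumRange.contDiffAt_supportPoint_iff hreg).2 hm.1)
    · exact hm.2 ((NumRange.contDiffAt_supportPoint_iff hreg).1
        ((NumRange.contMDiffAt_reverseGauss_iff hreg).1 h))
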